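/- **Theorem.** A simple stochastic game (SSG) is a finite directed graph $G=(V,A)$ with every outdegree at least $1$, whose node set is partitioned into $V_{\max},V_{\min},V_{\mathrm{ran}},V_{\mathrm{sink}}$; the only arc leaving a sink is a loop, each sink $s$ carries a rational value $\mathrm{Val}(s)$, and each $x\in V_{\mathrm{ran}}$ carries a rational probability distribution on its out-neighbours. It is max-binary if every max-node has outdegree exactly $2$. A max-strategy $\sigma$ (resp. min-strategy $\tau$) chooses an out-neighbour of every max-node (resp. min-node). Together with an initial node $x$, the pair $(\sigma,\tau)$ defines a random play; $\mathrm{Val}_{\sigma,\tau}(x)$ is the expectation of the value of the sink reached by the play ($0$ if no sink is reached), and $\mathrm{Val}_{\sigma,*}(x)=\min_\tau \mathrm{Val}_{\sigma,\tau}(x)$. The strategy $\sigma$ is optimal if $\mathrm{Val}_{\sigma,*}(x)=\max_{\sigma'}\mathrm{Val}_{\sigma',*}(x)$ for all $x\in V$. It is stopping if, for every $\tau$ and every initial node, the play reaches a sink with probability $1$. A max-node $x$ is switchable for $\sigma$ if it has an out-neighbour $y$ with $\mathrm{Val}_{\sigma,*}(y)>\mathrm{Val}_{\sigma,*}(\sigma(x))$;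 in a max-binary game, switching $\sigma$ at $x$ means replacing $\sigma(x)$ by the other out-neighbour of $x$. Let $G$ be a max-binary SSG and let $\sigma_0$ be a stopping max-strategy. Consider the following algorithm. Pick once, uniformly at random, a total order $\Theta$ on $V_{\max}$ and set $\sigma=\sigma_0$. While $\sigma$ is not optimal and has a switchable node, switch $\sigma$ at its switchable node that comes first in $\Theta$. Return $\sigma$. Then the expected number (over $\Theta$) of strategies considered by the algorithm, the initial and the final one included and a run that never ends counting as $\infty$, is at most $e^{2\sqrt{|V_{\max}|}}$. Moreover, if all sink values are nonnegative or all max-strategies of $G$ are stopping, then for every order $\Theta$ the algorithm returns an optimal max-strategy (so that the loop is left exactly when $\sigma$ is optimal). -/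

import Mathlib

open MeasureTheory ProbabilityTheory
open scoped ENNReal

noncomputable section

/-- The four kinds of nodes of a simple stochastic game. -/
inductive NodeKind where
  | max
  | min
  | ran
  | sink

/-- A simple stochastic game on the finite node set `V`. The field `val` is only read at sinks
and the field `prob` only at random nodes. -/
structure SSG (V : Type*) [Fintype V] where
  Arc : V → V → Prop
  kind : V → NodeKind
  exists_arc : ∀ x, ∃ y, Arc x y
  sink_arc : ∀ x, kind x = NodeKind.sink → ∀ y, Arc x y ↔ y = x
  val : V → ℚ
  prob : V → V → ℚ
  prob_nonneg : ∀ x, kind x = NodeKind.ran → ∀ y, 0 ≤ prob x y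
  prob_arc : ∀ x, kind x = NodeKind.ran → ∀ y, prob x y ≠ 0 → Arc x y
  prob_sum : ∀ x, kind x = NodeKind.ran → ∑ y, prob x y = 1

namespace SSG

variable {V : Type*} [Fintype V]

/-- The type of max-nodes. -/
abbrev MaxNode (G : SSG V) : Type _ := {x : V // G.kind x = NodeKind.max}

/-- The type of min-nodes. -/
abbrev MinNode (G : SSG V) : Type _ := {x : V // G.kind x = NodeKind.min}

/-- Pure stationary strategies of player max. -/
abbrev MaxStrategy (G : SSG V) : Type _ := {σ : G.MaxNode → V // ∀ x, G.Arc x.1 (σ x)}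

/-- Pure stationary strategies of player min. -/
abbrev MinStrategy (G : SSG V) : Type _ := {τ : G.MinNode → V // ∀ x, G.Arc x.1 (τ x)}

/-- Every max-node has outdegree exactly two. -/
def IsMaxBinary (G : SSG V) : Prop :=
  ∀ x : G.MaxNode, {y : V | G.Arc x.1 y}.ncard = 2

/-- The number of max-nodes. -/
def numMax (G : SSG V) : ℕ := Nat.card G.MaxNode

/-! ### Random plays and values -/

section Play

variable [MeasurableSpace V]

/-- The law of the successor of the node `x` in the play governed by `σ` and `τ`. -/
def stepLaw (G : SSG V) (σ : G.MaxStrategy) (τ : G.MinStrategy) (x : V) : Measure V :=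
  match h : G.kind x with
  | NodeKind.max => Measure.dirac (σ.1 ⟨x, h⟩)
  | NodeKind.min => Measure.dirac (τ.1 ⟨x, h⟩)
  | NodeKind.ran => ∑ y, ENNReal.ofReal (G.prob x y : ℝ) • Measure.dirac y
  | NodeKind.sink => Measure.dirac x

theorem stepLaw_isProbabilityMeasure (G : SSG V) (σ : G.MaxStrategy) (τ : G.MinStrategy) (x : V) :
    IsProbabilityMeasure (G.stepLaw σ τ x) := by
  unfold stepLaw
  split
  · infer_instance
  · infer_instance
  · rename_i h
    constructor
    have h1 : (∑ y, (G.prob x y : ℝ)) = 1 := by exact_mod_cast G.prob_sum x h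
    simp only [Measure.finsetSum_apply, Measure.smul_apply, measure_univ, smul_eq_mul, mul_one]
    rw [← ENNReal.ofReal_sum_of_nonneg, h1, ENNReal.ofReal_one]
    intro y _
    exact_mod_cast G.prob_nonneg x h y
  · infer_instance

variable [DiscreteMeasurableSpace V]

/-- The one-step transition kernel of the Markov chain governed by `σ` and `τ`. -/
def stepKernel (G : SSG V) (σ : G.MaxStrategy) (τ : G.MinStrategy) : Kernel V V where
  toFun := G.stepLaw σ τ
  measurable' := Measurable.of_discrete

instance stepKernel_isMarkovKernel (G : SSG V) (σ : G.MaxStrategy) (τ : G.MinStrategy) :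
    IsMarkovKernel (G.stepKernel σ τ) :=
  ⟨fun x => G.stepLaw_isProbabilityMeasure σ τ x⟩

/-- The same transition, as a kernel from the histories `x₀, …, xₙ` to the next node. -/
def historyKernel (G : SSG V) (σ : G.MaxStrategy) (τ : G.MinStrategy) (n : ℕ) :
    Kernel ((_ : Finset.Iic n) → V) V :=
  (G.stepKernel σ τ).comap (fun h => h ⟨n, Finset.mem_Iic.2 le_rfl⟩) (measurable_pi_apply _)

instance historyKernel_isMarkovKernel (G : SSG V) (σ : G.MaxStrategy) (τ : G.MinStrategy)
    (n : ℕ) : IsMarkovKernel (G.historyKernel σ τ n) := by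
  unfold historyKernel
  infer_instance

/-- The probability measure on plays `x₀, x₁, …` started at `x` and governed by `σ` and `τ`. -/
def playLaw (G : SSG V) (σ : G.MaxStrategy) (τ : G.MinStrategy) (x : V) : Measure (ℕ → V) :=
  Kernel.traj (X := fun _ : ℕ => V) (G.historyKernel σ τ) 0 (fun _ => x)

/-- The play `ω` reaches a sink. -/
def ReachesSink (G : SSG V) (ω : ℕ → V) : Prop := ∃ t, G.kind (ω t) = NodeKind.sink

open Classical in
/-- The value of the sink reached by the play `ω` if there is one, and `0` otherwise. -/
def payoff (G : SSG V) (ω : ℕ → V) : ℝ :=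
  if h : G.ReachesSink ω then (G.val (ω (Nat.find h)) : ℝ) else 0

/-- The value `Val_{σ,τ}(x)`. -/
def value (G : SSG V) (σ : G.MaxStrategy) (τ : G.MinStrategy) (x : V) : ℝ :=
  ∫ ω, G.payoff ω ∂(G.playLaw σ τ x)

/-- The value `Val_{σ,*}(x)`, a minimum over the finitely many min-strategies. -/
def lowerValue (G : SSG V) (σ : G.MaxStrategy) (x : V) : ℝ :=
  ⨅ τ : G.MinStrategy, G.value σ τ x

/-- The value `Val_{*,*}(x)`, a maximum over the finitely many max-strategies. -/
def gameValue (G : SSG V) (x : V) : ℝ :=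
  ⨆ σ : G.MaxStrategy, G.lowerValue σ x

/-- `σ` is an optimal max-strategy. -/
def IsOptimal (G : SSG V) (σ : G.MaxStrategy) : Prop :=
  ∀ x, G.lowerValue σ x = G.gameValue x

/-- `σ` is stopping: against every min-strategy, and from every initial node, the random play
reaches a sink with probability one. -/
def IsStopping (G : SSG V) (σ : G.MaxStrategy) : Prop :=
  ∀ (τ : G.MinStrategy) (x : V), ∀ᵐ ω ∂(G.playLaw σ τ x), G.ReachesSink ω

/-! ### The algorithm -/

/-- The max-node `x` is switchable for `σ`. -/
def IsSwitchable (G : SSG V) (σ : G.MaxStrategy) (x : G.MaxNode) : Prop :=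
  ∃ y, G.Arc x.1 y ∧ G.lowerValue σ (σ.1 x) < G.lowerValue σ y

open Classical in
/-- The strategy obtained from `σ` by moving its choice at `x` to an out-neighbour of `x` other
than `σ x`; in a max-binary game there is exactly one. -/
def switch (G : SSG V) (σ : G.MaxStrategy) (x : G.MaxNode) : G.MaxStrategy :=
  if h : ∃ y, G.Arc x.1 y ∧ y ≠ σ.1 x then
    ⟨Function.update σ.1 x h.choose, fun z => by
      rcases eq_or_ne z x with rfl | hz
      · simpa using h.choose_spec.1
      · simpa [Function.update_of_ne hz] using σ.2 z⟩
  else σ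

/-- A total order on the max-nodes, given by the rank of each max-node; this is a bijection
between the two notions. -/
abbrev NodeOrder (G : SSG V) : Type _ := G.MaxNode ≃ Fin G.numMax

/-- `x` is the first switchable node of `σ` in the order `Θ`. -/
def IsFirstSwitchable (G : SSG V) (Θ : G.NodeOrder) (σ : G.MaxStrategy) (x : G.MaxNode) : Prop :=
  G.IsSwitchable σ x ∧ ∀ y, G.IsSwitchable σ y → Θ x ≤ Θ y

open Classical in
/-- One iteration of the loop: `none` if the loop is left at `σ`, because `σ` is optimal or has no
switchable node, and otherwise the strategy obtained by switching `σ` at its first switchable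
node. -/
def next (G : SSG V) (Θ : G.NodeOrder) (σ : G.MaxStrategy) : Option G.MaxStrategy :=
  if G.IsOptimal σ then none
  else if h : ∃ x, G.IsFirstSwitchable Θ σ x then some (G.switch σ h.choose)
  else none

/-- The strategy held by the algorithm after `k` iterations, or `none` if it has stopped before. -/
def run (G : SSG V) (Θ : G.NodeOrder) (σ₀ : G.MaxStrategy) : ℕ → Option G.MaxStrategy
  | 0 => some σ₀
  | k + 1 => (run G Θ σ₀ k).bind (G.next Θ)

/-- The strategy `σ` is the output of the algorithm. -/
def Returns (G : SSG V) (Θ : G.NodeOrder) (σ₀ σ : G.MaxStrategy) : Prop :=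
  ∃ k, G.run Θ σ₀ k = some σ ∧ G.next Θ σ = none

/-- The number of strategies considered by the algorithm, the initial and the final one included;
it is `⊤` if the algorithm does not stop. -/
def numConsidered (G : SSG V) (Θ : G.NodeOrder) (σ₀ : G.MaxStrategy) : ℕ∞ :=
  {k : ℕ | (G.run Θ σ₀ k).isSome}.encard

open Classical in
/-- The expectation of the number of strategies considered, for a uniform order `Θ`. -/
def expectedConsidered (G : SSG V) (σ₀ : G.MaxStrategy) : ℝ≥0∞ :=
  (∑ Θ : G.NodeOrder, (G.numConsidered Θ σ₀ : ℝ≥0∞)) / (Fintype.card G.NodeOrder : ℝ≥0∞)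

end Play

end SSG

end

/-!
Call a max-strategy trap-free if no min-strategy can keep the play forever in a set without sinks;
stopping strategies are trap-free (`IsStopping.isTrapFree`). For fixed strategies the value function
is harmonic, is given by the sink values at sinks, and vanishes on traps, so a maximum principle
compares it with sub- and superharmonic functions (`nonpos_of_subharmonic`). Against a trap-free
strategy `σ` there is a uniformly best response, and comparison gives the two facts behind strategy
improvement: switching a switchable node keeps `σ` trap-free and increases its value
(`IsTrapFree.of_improve`, `IsTrapFree.lowerValue_lt_switch`), and a strategy that differs from `σ`
at non-switchable nodes only is not better than `σ` (`IsTrapFree.le_lowerValue`). The second fact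
also makes the final strategy optimal when the sink values are nonnegative or all strategies are
stopping (`IsTrapFree.isOptimal`).

The count only uses these two facts, which are axiomatized as a `SwitchingSystem`. Fix an order, and
let `i` be its last node. The algorithm first settles all other nodes, then flips `i` at most once,
then settles the other nodes again; this is the recursion of `bland`. The value `w i` reached before
the flip is the best one compatible with the initial choice at `i`. If `w j` is not above `w i`,
then after the flip of `i` no state can have the initial choice at `j` any more, so `j` is frozen at
the other choice. The vectors `w i` are only partially ordered; ranking them by the sum of their
entries makes all nodes comparable. As `i` is uniform, the number of nodes still active after the flip is bounded by a
uniform number in `0, …, d - 1` if there were `d` of them, which leads to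
`f d = f (d - 1) + (f 0 + ⋯ + f (d - 1)) / d`, solved by `f d = ∑ C(d, k) / k! ≤ exp (2 √d)`.

The order is drawn only once, and if values tie, then the state after the flip of `i` depends on the
order of the other nodes, so the recursion does not start afresh there. But the choices of this
state from any rank `p` on are determined by the order from rank `p` on (`choice_bland_congr`),
because the final value of a phase is unique even where the final state is not. The recursion is
therefore proved for all starts that are adapted in this sense (`IsAdapted`, `sum_numVisited_le`),
for which the initial choice at the last node is still known once that node is.
-/

noncomputable section

set_option linter.unusedSectionVars false

/-! ### The Markov chain of a pair of strategies -/

namespace SSG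

open Filter Topology

variable {V : Type*} [Fintype V] [MeasurableSpace V] [DiscreteMeasurableSpace V]
  (G : SSG V) (σ : G.MaxStrategy) (τ : G.MinStrategy)

/-- The probability of moving from `x` to `y` in one step of the play governed by `σ` and `τ`. -/
def trans (x y : V) : ℝ := (G.stepLaw σ τ x).real {y}

/-- The one-step expectation operator of the chain governed by `σ` and `τ`. -/
def stepMean (g : V → ℝ) (x : V) : ℝ := ∑ y, G.trans σ τ x y * g y

theorem integral_stepLaw (g : V → ℝ) (x : V) :
    ∫ y, g y ∂(G.stepLaw σ τ x) = G.stepMean σ τ g x := by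
  have := G.stepLaw_isProbabilityMeasure σ τ x
  rw [integral_fintype .of_finite]
  simp [stepMean, trans]

theorem trans_nonneg (x y : V) : 0 ≤ G.trans σ τ x y := measureReal_nonneg

theorem sum_trans (x : V) : ∑ y, G.trans σ τ x y = 1 := by
  have := G.stepLaw_isProbabilityMeasure σ τ x
  have h := G.integral_stepLaw σ τ (fun _ => 1) x
  simpa [stepMean] using h.symm

theorem stepLaw_max {x : V} (h : G.kind x = NodeKind.max) :
    G.stepLaw σ τ x = Measure.dirac (σ.1 ⟨x, h⟩) := by
  unfold stepLaw; split <;> first | rfl | (rename_i h'; cases h.symm.trans h')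

theorem stepLaw_min {x : V} (h : G.kind x = NodeKind.min) :
    G.stepLaw σ τ x = Measure.dirac (τ.1 ⟨x, h⟩) := by
  unfold stepLaw; split <;> first | rfl | (rename_i h'; cases h.symm.trans h')

theorem stepLaw_sink {x : V} (h : G.kind x = NodeKind.sink) :
    G.stepLaw σ τ x = Measure.dirac x := by
  unfold stepLaw; split <;> first | rfl | (rename_i h'; cases h.symm.trans h')

theorem stepMean_max (g : V → ℝ) {x : V} (h : G.kind x = NodeKind.max) :
    G.stepMean σ τ g x = g (σ.1 ⟨x, h⟩) := by
  rw [← integral_stepLaw, stepLaw_max _ _ _ h, integral_dirac]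

theorem stepMean_min (g : V → ℝ) {x : V} (h : G.kind x = NodeKind.min) :
    G.stepMean σ τ g x = g (τ.1 ⟨x, h⟩) := by
  rw [← integral_stepLaw, stepLaw_min _ _ _ h, integral_dirac]

theorem stepMean_sink (g : V → ℝ) {x : V} (h : G.kind x = NodeKind.sink) :
    G.stepMean σ τ g x = g x := by
  rw [← integral_stepLaw, stepLaw_sink _ _ _ h, integral_dirac]

/-- The law of the next node only depends on the choices made at the present node. -/
theorem stepLaw_congr {σ σ' : G.MaxStrategy} {τ τ' : G.MinStrategy} {x : V}
    (hσ : ∀ h : G.kind x = NodeKind.max, σ.1 ⟨x, h⟩ = σ'.1 ⟨x, h⟩)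
    (hτ : ∀ h : G.kind x = NodeKind.min, τ.1 ⟨x, h⟩ = τ'.1 ⟨x, h⟩) :
    G.stepLaw σ τ x = G.stepLaw σ' τ' x := by
  cases h : G.kind x with
  | max => rw [stepLaw_max _ _ _ h, stepLaw_max _ _ _ h, hσ]
  | min => rw [stepLaw_min _ _ _ h, stepLaw_min _ _ _ h, hτ]
  | sink => rw [stepLaw_sink _ _ _ h, stepLaw_sink _ _ _ h]
  | ran => unfold stepLaw; split <;> simp_all

theorem trans_congr {σ σ' : G.MaxStrategy} {τ τ' : G.MinStrategy} {x : V}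
    (hσ : ∀ h : G.kind x = NodeKind.max, σ.1 ⟨x, h⟩ = σ'.1 ⟨x, h⟩)
    (hτ : ∀ h : G.kind x = NodeKind.min, τ.1 ⟨x, h⟩ = τ'.1 ⟨x, h⟩) (y : V) :
    G.trans σ τ x y = G.trans σ' τ' x y := by
  rw [trans, trans, G.stepLaw_congr hσ hτ]

theorem stepMean_congr {σ σ' : G.MaxStrategy} {τ τ' : G.MinStrategy} {x : V}
    (hσ : ∀ h : G.kind x = NodeKind.max, σ.1 ⟨x, h⟩ = σ'.1 ⟨x, h⟩)
    (hτ : ∀ h : G.kind x = NodeKind.min, τ.1 ⟨x, h⟩ = τ'.1 ⟨x, h⟩) (g : V → ℝ) :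
    G.stepMean σ τ g x = G.stepMean σ' τ' g x := by
  simp only [stepMean, G.trans_congr hσ hτ]

theorem stepMean_sub (f g : V → ℝ) (x : V) :
    G.stepMean σ τ (fun y => f y - g y) x = G.stepMean σ τ f x - G.stepMean σ τ g x := by
  simp [stepMean, mul_sub]

/-- A trap of the chain governed by `σ` and `τ`: a set of nodes without sinks that the chain never
leaves. -/
def IsTrap (M : Set V) : Prop :=
  (∀ x ∈ M, G.kind x ≠ NodeKind.sink) ∧ ∀ x ∈ M, ∀ y, G.trans σ τ x y ≠ 0 → y ∈ M

/-! ### Finite-time laws of the play -/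

instance (x : V) : IsProbabilityMeasure (G.playLaw σ τ x) := by
  unfold playLaw; infer_instance

/-- The Markov property of the play, for functions of two consecutive nodes. -/
theorem integral_playLaw_succ (g : V → V → ℝ) (x : V) (n : ℕ) :
    ∫ ω, g (ω n) (ω (n + 1)) ∂(G.playLaw σ τ x) =
      ∫ ω, G.stepMean σ τ (g (ω n)) (ω n) ∂(G.playLaw σ τ x) := by
  have hg : Measurable (Function.uncurry g) := .of_discrete
  have hm : Measurable fun ω : ℕ → V =>
      (Preorder.frestrictLe (π := fun _ : ℕ => V) n ω, ω (n + 1)) := by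
    fun_prop
  have hF : Measurable fun p : ((_ : Finset.Iic n) → V) × V =>
      g (p.1 ⟨n, Finset.mem_Iic.2 le_rfl⟩) p.2 :=
    by exact hg.comp (f := fun p : ((_ : Finset.Iic n) → V) × V =>
        (p.1 ⟨n, Finset.mem_Iic.2 le_rfl⟩, p.2)) (by fun_prop)
  have key := Kernel.partialTraj_compProd_eq_map_traj (X := fun _ : ℕ => V)
    (κ := G.historyKernel σ τ) (Nat.zero_le n) (x₀ := fun _ => x)
  have h1 : ∫ ω, g (ω n) (ω (n + 1)) ∂(G.playLaw σ τ x) =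
      ∫ p, g (p.1 ⟨n, Finset.mem_Iic.2 le_rfl⟩) p.2 ∂((G.playLaw σ τ x).map
        fun ω : ℕ → V => (Preorder.frestrictLe (π := fun _ : ℕ => V) n ω, ω (n + 1))) := by
    rw [integral_map hm.aemeasurable hF.aestronglyMeasurable]
    rfl
  obtain ⟨C, hC⟩ : ∃ C, ∀ p : V × V, ‖g p.1 p.2‖ ≤ C := by
    obtain ⟨C, hC⟩ := (Set.finite_range fun p : V × V => ‖g p.1 p.2‖).bddAbove
    exact ⟨C, fun p => hC ⟨p, rfl⟩⟩
  rw [h1, playLaw, ← key, Measure.integral_compProd]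
  · have h2 : ∀ h : (_ : Finset.Iic n) → V,
        ∫ y, g (h ⟨n, Finset.mem_Iic.2 le_rfl⟩) y ∂(G.historyKernel σ τ n h) =
        G.stepMean σ τ (g (h ⟨n, Finset.mem_Iic.2 le_rfl⟩)) (h ⟨n, Finset.mem_Iic.2 le_rfl⟩) := by
      intro h
      rw [← integral_stepLaw]
      rfl
    simp only [h2]
    rw [← Kernel.traj_map_frestrictLe_apply, integral_map (by fun_prop)]
    · rfl
    · have : Measurable fun z : V => G.stepMean σ τ (g z) z := .of_discrete
      exact (this.comp (measurable_pi_apply _)).aestronglyMeasurable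
  · exact .of_bound hF.aestronglyMeasurable C (ae_of_all _ fun p => hC (_, _))

theorem playLaw_zero (x : V) : ∀ᵐ ω ∂(G.playLaw σ τ x), ω 0 = x := by
  have h := Kernel.traj_map_frestrictLe_apply (X := fun _ : ℕ => V)
    (κ := G.historyKernel σ τ) 0 0 (fun _ => x)
  rw [Kernel.partialTraj_self, Kernel.id_apply] at h
  have h2 : ∀ᵐ p ∂((G.playLaw σ τ x).map (Preorder.frestrictLe (π := fun _ : ℕ => V) 0)),
      p ⟨0, Finset.mem_Iic.2 le_rfl⟩ = x := by
    rw [playLaw, h, ae_dirac_iff]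
    exact measurable_pi_apply (X := fun _ : Finset.Iic 0 => V) ⟨0, Finset.mem_Iic.2 le_rfl⟩
      (MeasurableSet.of_discrete (s := {x}))
  exact ae_of_ae_map (by fun_prop) h2

/-- The expectation of a function of the `t`-th node is the `t`-fold iterate of `stepMean`. -/
theorem integral_playLaw_coord (t : ℕ) (f : V → ℝ) (x : V) :
    ∫ ω, f (ω t) ∂(G.playLaw σ τ x) = ((G.stepMean σ τ)^[t] f) x := by
  induction t generalizing f with
  | zero =>
    rw [integral_congr_ae (g := fun _ => f x)]
    · simp
    · filter_upwards [G.playLaw_zero σ τ x] with ω h using by rw [h]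
  | succ t ih =>
    rw [G.integral_playLaw_succ σ τ (fun _ y => f y), Function.iterate_succ_apply, ← ih]

/-- Almost surely the play stays in a sink once it has reached it. -/
theorem playLaw_sink_succ (x : V) :
    ∀ᵐ ω ∂(G.playLaw σ τ x), ∀ t, G.kind (ω t) = NodeKind.sink → ω (t + 1) = ω t := by
  classical
  rw [ae_all_iff]
  intro t
  let g : V → V → ℝ := fun y z => if G.kind y = NodeKind.sink ∧ z ≠ y then 1 else 0
  have h := G.integral_playLaw_succ σ τ g x t
  have h0 : ∀ y, G.stepMean σ τ (g y) y = 0 := by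
    intro y
    by_cases hy : G.kind y = NodeKind.sink
    · rw [stepMean_sink _ _ _ _ hy]; simp [g]
    · simp [stepMean, g, hy]
  simp only [h0, integral_zero] at h
  have hg : Measurable (Function.uncurry g) := .of_discrete
  have hm : Measurable fun ω : ℕ → V => g (ω t) (ω (t + 1)) :=
    by exact hg.comp (f := fun ω : ℕ → V => (ω t, ω (t + 1))) (by fun_prop)
  have hnn : ∀ y z, 0 ≤ g y z := fun y z => by dsimp only [g]; split_ifs <;> norm_num
  rw [integral_eq_zero_iff_of_nonneg (fun ω => hnn _ _)] at h
  · filter_upwards [h] with ω hω hs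
    by_contra hne
    simp [g, hs, hne] at hω
  · refine .of_bound hm.aestronglyMeasurable 1 (ae_of_all _ fun ω => ?_)
    dsimp only [g]; split_ifs <;> simp

/-! ### The value of a pair of strategies -/

open Classical in
/-- The value of `y` if `y` is a sink, and `0` otherwise. -/
def sinkGain (y : V) : ℝ := if G.kind y = NodeKind.sink then (G.val y : ℝ) else 0

open Classical in
theorem tendsto_iterate_stepMean (x : V) :
    Tendsto (fun t => ((G.stepMean σ τ)^[t] G.sinkGain) x) atTop (𝓝 (G.value σ τ x)) := by
  simp only [← integral_playLaw_coord]
  obtain ⟨C, hC⟩ : ∃ C, ∀ y : V, ‖G.sinkGain y‖ ≤ C := by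
    obtain ⟨C, hC⟩ := (Set.finite_range fun y => ‖G.sinkGain y‖).bddAbove
    exact ⟨C, fun p => hC ⟨p, rfl⟩⟩
  have hgm : Measurable G.sinkGain := .of_discrete
  refine tendsto_integral_of_dominated_convergence (fun _ => C)
    (fun t => (hgm.comp (measurable_pi_apply t)).aestronglyMeasurable) (integrable_const _)
    (fun t => ae_of_all _ fun ω => hC _) ?_
  filter_upwards [G.playLaw_sink_succ σ τ x] with ω hω
  by_cases h : G.ReachesSink ω
  · have hT := Nat.find_spec h
    have hconst : ∀ t, Nat.find h ≤ t → ω t = ω (Nat.find h) := by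
      intro t ht
      induction t, ht using Nat.le_induction with
      | base => rfl
      | succ t ht ih => rw [hω t (by rw [ih]; exact hT), ih]
    refine tendsto_const_nhds.congr' ?_
    filter_upwards [eventually_ge_atTop (Nat.find h)] with t ht
    rw [hconst t ht, payoff, dif_pos h, sinkGain, if_pos hT]
  · have h' : ∀ t, G.sinkGain (ω t) = 0 := fun t => if_neg fun ht => h ⟨t, ht⟩
    simp [h', payoff, h]

/-- The value function is harmonic. -/
theorem value_eq_stepMean (x : V) : G.value σ τ x = G.stepMean σ τ (G.value σ τ) x := by
  refine tendsto_nhds_unique ((tendsto_add_atTop_iff_nat 1).2 (G.tendsto_iterate_stepMean σ τ x)) ?_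
  simp only [Function.iterate_succ_apply']
  exact tendsto_finsetSum _ fun y _ => (G.tendsto_iterate_stepMean σ τ y).const_mul _

/-- A function constant on a set that the chain never leaves keeps its expectation there. -/
theorem iterate_stepMean_of_closed {M : Set V}
    (hM : ∀ x ∈ M, ∀ y, G.trans σ τ x y ≠ 0 → y ∈ M) {f : V → ℝ} {c : ℝ} (hf : ∀ x ∈ M, f x = c)
    (t : ℕ) : ∀ x ∈ M, ((G.stepMean σ τ)^[t] f) x = c := by
  induction t with
  | zero => exact hf
  | succ t ih =>
    intro x hx
    rw [Function.iterate_succ_apply', stepMean]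
    calc _ = ∑ y, G.trans σ τ x y * c := by
          refine Finset.sum_congr rfl fun y _ => ?_
          by_cases h : G.trans σ τ x y = 0
          · simp [h]
          · rw [ih y (hM x hx y h)]
      _ = c := by rw [← Finset.sum_mul, sum_trans, one_mul]

theorem value_sink {x : V} (h : G.kind x = NodeKind.sink) : G.value σ τ x = G.val x := by
  refine tendsto_nhds_unique (G.tendsto_iterate_stepMean σ τ x)
    (tendsto_const_nhds.congr fun t => ?_)
  symm
  refine G.iterate_stepMean_of_closed σ τ (M := {x}) ?_ (fun y hy => ?_) t x rfl
  · rintro _ rfl y hy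
    rw [trans, G.stepLaw_sink _ _ h] at hy
    by_contra hne
    exact hy (by simp [Measure.real, Ne.symm hne])
  · rw [Set.mem_singleton_iff.1 hy, sinkGain, if_pos h]

theorem IsTrap.value_eq_zero {G : SSG V} {σ : G.MaxStrategy} {τ : G.MinStrategy} {M : Set V}
    (hM : G.IsTrap σ τ M) {x : V} (hx : x ∈ M) : G.value σ τ x = 0 := by
  refine tendsto_nhds_unique (G.tendsto_iterate_stepMean σ τ x)
    (tendsto_const_nhds.congr fun t => ?_)
  exact (G.iterate_stepMean_of_closed σ τ hM.2 (fun y hy => if_neg (hM.1 y hy)) t x hx).symm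

/-- Against a stopping strategy no nonempty trap can be formed. -/
theorem IsStopping.not_isTrap {G : SSG V} {σ : G.MaxStrategy} (hσ : G.IsStopping σ)
    (τ : G.MinStrategy) {M : Set V} (hM : G.IsTrap σ τ M) {x : V} : x ∉ M := by
  classical
  intro hx
  have hnot : ∀ᵐ ω ∂(G.playLaw σ τ x), ∀ t, G.kind (ω t) ≠ NodeKind.sink := by
    rw [ae_all_iff]
    intro t
    let f : V → ℝ := fun y => if G.kind y = NodeKind.sink then 1 else 0
    have hfm : Measurable f := .of_discrete
    have h := G.integral_playLaw_coord σ τ t f x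
    rw [G.iterate_stepMean_of_closed σ τ hM.2 (fun y hy => if_neg (hM.1 y hy)) t x hx,
      integral_eq_zero_iff_of_nonneg (fun ω => by dsimp only [f]; positivity)] at h
    · filter_upwards [h] with ω hω hs
      simp [f, hs] at hω
    · refine .of_bound (hfm.comp (measurable_pi_apply t)).aestronglyMeasurable 1
        (ae_of_all _ fun ω => ?_)
      dsimp only [f, Function.comp]; split_ifs <;> simp
  obtain ⟨ω, ⟨t, ht⟩, h⟩ := ((hσ τ x).and hnot).exists
  exact h t ht

end SSG

/-! ### Comparison principles -/

namespace SSG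

variable {V : Type*} [Fintype V] [MeasurableSpace V] [DiscreteMeasurableSpace V]
  (G : SSG V) (σ : G.MaxStrategy) (τ : G.MinStrategy)

/-- Equality case of averaging: if a mean of values bounded by `c` is at least `c`, then all values
of positive weight are equal to `c`. -/
theorem eq_of_le_stepMean {g : V → ℝ} {x : V} {c : ℝ}
    (hle : ∀ y, G.trans σ τ x y ≠ 0 → g y ≤ c) (h : c ≤ G.stepMean σ τ g x) :
    ∀ y, G.trans σ τ x y ≠ 0 → g y = c := by
  have hnn : ∀ y ∈ Finset.univ, 0 ≤ G.trans σ τ x y * (c - g y) := by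
    intro y _
    by_cases hy : G.trans σ τ x y = 0
    · simp [hy]
    · exact mul_nonneg (G.trans_nonneg σ τ x y) (sub_nonneg.2 (hle y hy))
  have hsum : ∑ y, G.trans σ τ x y * (c - g y) = 0 := by
    refine le_antisymm ?_ (Finset.sum_nonneg hnn)
    simp only [mul_sub, Finset.sum_sub_distrib, ← Finset.sum_mul, sum_trans, one_mul]
    exact sub_nonpos.2 h
  intro y hy
  have := (Finset.sum_eq_zero_iff_of_nonneg hnn).1 hsum y (Finset.mem_univ y)
  rcases mul_eq_zero.1 this with h0 | h0
  · exact absurd h0 hy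
  · linarith

/-- Maximum principle: the set where a subharmonic function attains a positive maximum would be a
trap. -/
theorem nonpos_of_subharmonic {d : V → ℝ}
    (hsub : ∀ x, G.kind x ≠ NodeKind.sink → d x ≤ G.stepMean σ τ d x)
    (hsink : ∀ x, G.kind x = NodeKind.sink → d x ≤ 0)
    (htrap : ∀ M, G.IsTrap σ τ M → ∀ x ∈ M, d x ≤ 0) (x : V) : d x ≤ 0 := by
  by_contra! hx
  have : Nonempty V := ⟨x⟩
  obtain ⟨x₀, hx₀⟩ := Finite.exists_max d
  have hpos : 0 < d x₀ := hx.trans_le (hx₀ x)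
  refine hpos.not_ge (htrap {z | d z = d x₀} ⟨?_, ?_⟩ x₀ rfl)
  · intro z (hz : d z = d x₀) hs
    exact hpos.not_ge (hz ▸ hsink z hs)
  · intro z (hz : d z = d x₀) y hy
    have hns : G.kind z ≠ NodeKind.sink := fun hs => hpos.not_ge (hz ▸ hsink z hs)
    exact G.eq_of_le_stepMean σ τ (fun y _ => hx₀ y) (hz ▸ hsub z hns) y hy

theorem le_value_of_subharmonic {w : V → ℝ}
    (hsub : ∀ x, G.kind x ≠ NodeKind.sink → w x ≤ G.stepMean σ τ w x)
    (hsink : ∀ x, G.kind x = NodeKind.sink → w x ≤ G.val x)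
    (htrap : ∀ M, G.IsTrap σ τ M → ∀ x ∈ M, w x ≤ 0) (x : V) : w x ≤ G.value σ τ x := by
  refine sub_nonpos.1 (G.nonpos_of_subharmonic σ τ (d := fun y => w y - G.value σ τ y)
    (fun y hy => ?_) (fun y hy => ?_) (fun M hM y hy => ?_) x)
  · rw [stepMean_sub, ← value_eq_stepMean]
    exact sub_le_sub_right (hsub y hy) _
  · rw [G.value_sink σ τ hy]
    exact sub_nonpos.2 (hsink y hy)
  · rw [hM.value_eq_zero hy, sub_zero]
    exact htrap M hM y hy

theorem value_le_of_superharmonic {w : V → ℝ}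
    (hsup : ∀ x, G.kind x ≠ NodeKind.sink → G.stepMean σ τ w x ≤ w x)
    (hsink : ∀ x, G.kind x = NodeKind.sink → (G.val x : ℝ) ≤ w x)
    (htrap : ∀ M, G.IsTrap σ τ M → ∀ x ∈ M, 0 ≤ w x) (x : V) : G.value σ τ x ≤ w x := by
  refine sub_nonpos.1 (G.nonpos_of_subharmonic σ τ (d := fun y => G.value σ τ y - w y)
    (fun y hy => ?_) (fun y hy => ?_) (fun M hM y hy => ?_) x)
  · rw [stepMean_sub, ← value_eq_stepMean]
    exact sub_le_sub_left (hsup y hy) _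
  · rw [G.value_sink σ τ hy]
    exact sub_nonpos.2 (hsink y hy)
  · rw [hM.value_eq_zero hy, zero_sub, neg_nonpos]
    exact htrap M hM y hy

theorem value_nonneg (h : ∀ x, G.kind x = NodeKind.sink → 0 ≤ G.val x) (x : V) :
    0 ≤ G.value σ τ x := by
  refine G.le_value_of_subharmonic σ τ (w := fun _ => 0) (fun y _ => ?_) (fun y hy => ?_)
    (fun _ _ _ _ => le_rfl) x
  · simp [stepMean]
  · exact_mod_cast h y hy

theorem trans_max {x : V} (h : G.kind x = NodeKind.max) : G.trans σ τ x (σ.1 ⟨x, h⟩) ≠ 0 := by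
  rw [trans, G.stepLaw_max _ _ h]
  simp [Measure.real]

/-! ### Best responses and the value of a max-strategy -/

/-- No min-strategy forms a nonempty trap against `σ`. Stopping strategies have this property, and
it is all that is used of them. -/
def IsTrapFree : Prop := ∀ (τ : G.MinStrategy) (M : Set V), G.IsTrap σ τ M → ∀ x, x ∉ M

theorem IsStopping.isTrapFree {G : SSG V} {σ : G.MaxStrategy} (h : G.IsStopping σ) :
    G.IsTrapFree σ := fun τ _ hM _ => h.not_isTrap τ hM

instance : Nonempty G.MinStrategy :=
  ⟨⟨fun x => (G.exists_arc x.1).choose, fun x => (G.exists_arc x.1).choose_spec⟩⟩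

theorem lowerValue_le_value (x : V) : G.lowerValue σ x ≤ G.value σ τ x :=
  ciInf_le (Set.finite_range fun τ => G.value σ τ x).bddBelow τ

variable {G σ}

/-- Against a trap-free strategy, a min-strategy whose values have the least sum cannot be improved
at any arc. -/
theorem IsTrapFree.exists_locally_best (hσ : G.IsTrapFree σ) :
    ∃ τ : G.MinStrategy, ∀ x y, G.kind x = NodeKind.min → G.Arc x y →
      G.value σ τ x ≤ G.value σ τ y := by
  classical
  obtain ⟨τ, hτ⟩ := Finite.exists_min fun τ : G.MinStrategy => ∑ x, G.value σ τ x
  refine ⟨τ, fun x y hx hxy => ?_⟩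
  by_contra! hlt
  let τ' : G.MinStrategy := ⟨Function.update τ.1 ⟨x, hx⟩ y, fun z => by
    rcases eq_or_ne z ⟨x, hx⟩ with rfl | hz
    · simpa using hxy
    · simpa [Function.update_of_ne hz] using τ.2 z⟩
  have hτ'x : τ'.1 ⟨x, hx⟩ = y := Function.update_self ..
  have hle : ∀ z, G.value σ τ' z ≤ G.value σ τ z := by
    refine G.value_le_of_superharmonic σ τ' (fun z _ => ?_) (fun z hz => ?_)
      (fun M hM z hz => absurd hz (hσ τ' M hM z))
    · by_cases hz : z = x
      · subst hz
        rw [G.stepMean_min _ _ _ hx, hτ'x]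
        exact hlt.le
      · rw [G.value_eq_stepMean σ τ z]
        refine (G.stepMean_congr (fun _ => rfl) (fun h => ?_) _).le
        exact Function.update_of_ne (fun h' => hz (congrArg Subtype.val h')) ..
    · rw [G.value_sink _ _ hz]
  have hlt' : G.value σ τ' x < G.value σ τ x := by
    rw [G.value_eq_stepMean σ τ', G.stepMean_min _ _ _ hx, hτ'x]
    exact (hle y).trans_lt hlt
  exact (hτ τ').not_gt (Finset.sum_lt_sum (fun z _ => hle z) ⟨x, Finset.mem_univ x, hlt'⟩)

/-- A trap-free strategy has a stationary best response, optimal from all initial nodes at once. -/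
theorem IsTrapFree.exists_bestResponse (hσ : G.IsTrapFree σ) :
    ∃ τ : G.MinStrategy, G.lowerValue σ = G.value σ τ ∧ ∀ x y, G.kind x = NodeKind.min →
      G.Arc x y → G.value σ τ x ≤ G.value σ τ y := by
  obtain ⟨τ, hτ⟩ := hσ.exists_locally_best
  refine ⟨τ, funext fun x => le_antisymm (G.lowerValue_le_value σ τ x) (le_ciInf fun τ' => ?_), hτ⟩
  refine G.le_value_of_subharmonic σ τ' (fun z _ => ?_) (fun z hz => ?_)
    (fun M hM z hz => absurd hz (hσ τ' M hM z)) x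
  · by_cases hz : G.kind z = NodeKind.min
    · rw [G.stepMean_min _ _ _ hz]
      exact hτ z _ hz (τ'.2 ⟨z, hz⟩)
    · rw [G.value_eq_stepMean σ τ z]
      exact (G.stepMean_congr (fun _ => rfl) (fun h => absurd h hz) _).le
  · rw [G.value_sink _ _ hz]

theorem IsTrapFree.lowerValue_sink (hσ : G.IsTrapFree σ) {x : V} (hx : G.kind x = NodeKind.sink) :
    G.lowerValue σ x = G.val x := by
  obtain ⟨τ, hτ, -⟩ := hσ.exists_bestResponse
  rw [hτ, G.value_sink _ _ hx]

theorem IsTrapFree.lowerValue_max (hσ : G.IsTrapFree σ) (x : G.MaxNode) :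
    G.lowerValue σ x.1 = G.lowerValue σ (σ.1 x) := by
  obtain ⟨τ, hτ, -⟩ := hσ.exists_bestResponse
  rw [hτ, G.value_eq_stepMean, G.stepMean_max _ _ _ x.2]

/-- The value of `σ` is subharmonic for all chains in which max plays no worse than `σ` does. -/
theorem IsTrapFree.lowerValue_le_stepMean (hσ : G.IsTrapFree σ) (σ' : G.MaxStrategy)
    (τ' : G.MinStrategy) {x : V}
    (h : ∀ hx : G.kind x = NodeKind.max,
      G.lowerValue σ (σ.1 ⟨x, hx⟩) ≤ G.lowerValue σ (σ'.1 ⟨x, hx⟩)) :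
    G.lowerValue σ x ≤ G.stepMean σ' τ' (G.lowerValue σ) x := by
  by_cases hmax : G.kind x = NodeKind.max
  · rw [G.stepMean_max _ _ _ hmax, hσ.lowerValue_max ⟨x, hmax⟩]
    exact h hmax
  obtain ⟨τ, hτ, hmin⟩ := hσ.exists_bestResponse
  rw [hτ]
  by_cases hx : G.kind x = NodeKind.min
  · rw [G.stepMean_min _ _ _ hx]
    exact hmin _ _ hx (τ'.2 ⟨x, hx⟩)
  · conv_lhs => rw [G.value_eq_stepMean]
    exact (G.stepMean_congr (fun h => absurd h hmax) (fun h => absurd h hx) _).le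

/-! ### Strategy improvement -/

/-- Improving a trap-free strategy preserves trap-freeness: on a trap of the new strategy, the nodes
of largest old value form a smaller trap, which contains no changed node and hence is a trap of the
old strategy. -/
theorem IsTrapFree.of_improve (hσ : G.IsTrapFree σ) {σ' : G.MaxStrategy}
    (h : ∀ x, σ'.1 x = σ.1 x ∨ G.lowerValue σ (σ.1 x) < G.lowerValue σ (σ'.1 x)) :
    G.IsTrapFree σ' := by
  intro τ M hM x hx
  have : Nonempty M := ⟨⟨x, hx⟩⟩
  obtain ⟨⟨x₀, hx₀M⟩, hx₀⟩ := Finite.exists_max fun z : M => G.lowerValue σ z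
  have hstep : ∀ z ∈ M, G.lowerValue σ z = G.lowerValue σ x₀ →
      ∀ y, G.trans σ' τ z y ≠ 0 → G.lowerValue σ y = G.lowerValue σ x₀ := by
    intro z hz hzc
    refine G.eq_of_le_stepMean σ' τ (fun y hy => hx₀ ⟨y, hM.2 z hz y hy⟩) ?_
    rw [← hzc]
    refine hσ.lowerValue_le_stepMean σ' τ fun hmax => ?_
    rcases h ⟨z, hmax⟩ with h | h
    · rw [h]
    · exact h.le
  refine hσ τ {z | z ∈ M ∧ G.lowerValue σ z = G.lowerValue σ x₀}
    ⟨fun z hz => hM.1 z hz.1, fun z hz y hy => ?_⟩ x₀ ⟨hx₀M, rfl⟩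
  have hy' : G.trans σ' τ z y ≠ 0 := by
    refine (G.trans_congr (fun hmax => ?_) (fun _ => rfl) y).trans_ne hy
    rcases h ⟨z, hmax⟩ with h | h
    · exact h
    · rw [hstep z hz.1 hz.2 _ (G.trans_max σ' τ hmax), ← hσ.lowerValue_max ⟨z, hmax⟩] at h
      exact absurd hz.2 h.ne
  exact ⟨hM.2 z hz.1 y hy', hstep z hz.1 hz.2 y hy'⟩

theorem IsTrapFree.lowerValue_le_of_improve (hσ : G.IsTrapFree σ) {σ' : G.MaxStrategy}
    (hσ' : G.IsTrapFree σ')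
    (h : ∀ x, G.lowerValue σ (σ.1 x) ≤ G.lowerValue σ (σ'.1 x)) (x : V) :
    G.lowerValue σ x ≤ G.lowerValue σ' x :=
  le_ciInf fun τ => G.le_value_of_subharmonic σ' τ
    (fun _ _ => hσ.lowerValue_le_stepMean σ' τ fun hmax => h ⟨_, hmax⟩)
    (fun _ hz => (hσ.lowerValue_sink hz).le) (fun M hM z hz => absurd hz (hσ' τ M hM z)) x

/-- A strategy choosing no arc that improves on `σ` is no better than `σ`, provided that the plays
it lets run forever are not worth more than under `σ`. -/
theorem IsTrapFree.le_lowerValue (hσ : G.IsTrapFree σ) {σ' : G.MaxStrategy}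
    (htrap : ∀ τ M, G.IsTrap σ' τ M → ∀ x ∈ M, 0 ≤ G.lowerValue σ x)
    (h : ∀ x, G.lowerValue σ (σ'.1 x) ≤ G.lowerValue σ (σ.1 x)) (x : V) :
    G.lowerValue σ' x ≤ G.lowerValue σ x := by
  obtain ⟨τ, hτ, -⟩ := hσ.exists_bestResponse
  refine (G.lowerValue_le_value σ' τ x).trans (G.value_le_of_superharmonic σ' τ (fun z _ => ?_)
    (fun z hz => (hσ.lowerValue_sink hz).ge) (htrap τ) x)
  by_cases hmax : G.kind z = NodeKind.max
  · rw [G.stepMean_max _ _ _ hmax, hσ.lowerValue_max ⟨z, hmax⟩]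
    exact h _
  · rw [hτ]
    conv_rhs => rw [G.value_eq_stepMean]
    exact (G.stepMean_congr (fun h => absurd h hmax) (fun _ => rfl) _).le

/-- A trap-free strategy without switchable nodes is optimal if max gains nothing from infinite
plays, or cannot force any. -/
theorem IsTrapFree.isOptimal (hσ : G.IsTrapFree σ) (hsw : ∀ x, ¬ G.IsSwitchable σ x)
    (h : (∀ x, G.kind x = NodeKind.sink → 0 ≤ G.val x) ∨ ∀ σ : G.MaxStrategy, G.IsStopping σ) :
    G.IsOptimal σ := by
  intro x
  have : Nonempty G.MaxStrategy := ⟨σ⟩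
  refine le_antisymm (le_ciSup (Set.finite_range fun σ => G.lowerValue σ x).bddAbove σ)
    (ciSup_le fun σ' => hσ.le_lowerValue (fun τ M hM z hz => ?_) (fun z => ?_) x)
  · rcases h with h | h
    · exact le_ciInf fun τ => G.value_nonneg σ τ h z
    · exact absurd hz ((h σ').not_isTrap τ hM)
  · by_contra! hlt
    exact hsw z ⟨_, σ'.2 z, hlt⟩

/-! ### Switching in max-binary games -/

theorem switch_of_ne (σ : G.MaxStrategy) {x z : G.MaxNode} (h : z ≠ x) :
    (G.switch σ x).1 z = σ.1 z := by
  classical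
  unfold switch
  split_ifs
  · exact Function.update_of_ne h ..
  · rfl

theorem IsMaxBinary.eq_of_ne (hG : G.IsMaxBinary) {x : G.MaxNode} {a b c : V} (ha : G.Arc x.1 a)
    (hb : G.Arc x.1 b) (hc : G.Arc x.1 c) (hac : a ≠ c) (hbc : b ≠ c) : a = b := by
  obtain ⟨p, q, -, hpq⟩ := Set.ncard_eq_two.1 (hG x)
  have key : ∀ y, G.Arc x.1 y → y = p ∨ y = q := fun y hy => by
    have : y ∈ {y | G.Arc x.1 y} := hy
    simpa [hpq] using this
  rcases key a ha with rfl | rfl <;> rcases key b hb with rfl | rfl <;>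
    rcases key c hc with rfl | rfl <;> simp_all

theorem IsSwitchable.lowerValue_switch (hG : G.IsMaxBinary) {x : G.MaxNode}
    (h : G.IsSwitchable σ x) :
    G.lowerValue σ (σ.1 x) < G.lowerValue σ ((G.switch σ x).1 x) := by
  classical
  obtain ⟨y, hy, hlt⟩ := h
  have hne : y ≠ σ.1 x := fun h => hlt.ne' (by rw [h])
  have hex : ∃ y, G.Arc x.1 y ∧ y ≠ σ.1 x := ⟨y, hy, hne⟩
  have : (G.switch σ x).1 x = hex.choose := by
    unfold switch
    rw [dif_pos hex]
    exact Function.update_self ..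
  rw [this, hG.eq_of_ne hex.choose_spec.1 hy (σ.2 x) hex.choose_spec.2 hne]
  exact hlt

theorem IsTrapFree.switch (hσ : G.IsTrapFree σ) (hG : G.IsMaxBinary) {x : G.MaxNode}
    (h : G.IsSwitchable σ x) : G.IsTrapFree (G.switch σ x) := by
  refine hσ.of_improve fun z => ?_
  rcases eq_or_ne z x with rfl | hz
  · exact .inr (h.lowerValue_switch hG)
  · exact .inl (switch_of_ne σ hz)

/-- Switching a switchable node increases the value, strictly at that node. -/
theorem IsTrapFree.lowerValue_lt_switch (hσ : G.IsTrapFree σ) (hG : G.IsMaxBinary) {x : G.MaxNode}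
    (h : G.IsSwitchable σ x) : G.lowerValue σ < G.lowerValue (G.switch σ x) := by
  have hσ' := hσ.switch hG h
  have hlt := h.lowerValue_switch hG
  have hle : ∀ z, G.lowerValue σ z ≤ G.lowerValue (G.switch σ x) z := by
    refine hσ.lowerValue_le_of_improve hσ' fun z => ?_
    rcases eq_or_ne z x with rfl | hz
    · exact hlt.le
    · rw [switch_of_ne σ hz]
  refine Pi.lt_def.2 ⟨hle, x.1, ?_⟩
  rw [hσ.lowerValue_max, hσ'.lowerValue_max]
  exact hlt.trans_le (hle _)

end SSG

/-! ### The function `∑ C(d, k) / k!` -/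

open Finset in
/-- The bound on the expected number of strategies when `d` nodes can still change. -/
def switchBound (d : ℕ) : ℝ := ∑ k ∈ range (d + 1), (d.choose k : ℝ) / k.factorial

namespace SwitchBound

open Finset

theorem eq_sum_range {d n : ℕ} (h : d ≤ n) :
    switchBound d = ∑ k ∈ range (n + 1), (d.choose k : ℝ) / k.factorial := by
  refine sum_subset (range_subset_range.2 (by omega)) fun k _ hk => ?_
  rw [Nat.choose_eq_zero_of_lt (by simpa using hk)]
  simp

theorem mono : Monotone switchBound := by
  intro a b hab
  rw [eq_sum_range hab, switchBound]
  gcongr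

theorem nonneg (d : ℕ) : 0 ≤ switchBound d := sum_nonneg fun _ _ => by positivity

@[simp] theorem zero : switchBound 0 = 1 := by simp [switchBound]

theorem sum_range_choose_self (d j : ℕ) : ∑ k ∈ range d, k.choose j = d.choose (j + 1) := by
  induction d with
  | zero => simp
  | succ d ih => rw [sum_range_succ, ih, Nat.choose_succ_succ, add_comm]

/-- The recurrence satisfied by the bound. -/
theorem succ_mul (d : ℕ) :
    (d + 1) * switchBound (d + 1) = (d + 1) * switchBound d + ∑ k ∈ range (d + 1), switchBound k := by
  have h1 : ∑ k ∈ range (d + 1), switchBound k =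
      ∑ j ∈ range (d + 1), ((d + 1).choose (j + 1) : ℝ) / j.factorial := by
    rw [sum_congr rfl fun k hk => eq_sum_range (n := d) (Nat.lt_succ_iff.1 (mem_range.1 hk)),
      sum_comm]
    refine sum_congr rfl fun j _ => ?_
    rw [← sum_div, ← sum_range_choose_self]
    push_cast
    rfl
  have h2 : switchBound (d + 1) = switchBound d +
      ∑ j ∈ range (d + 1), (d.choose j : ℝ) / (j + 1).factorial := by
    rw [eq_sum_range (Nat.le_succ d), switchBound, sum_range_succ', sum_range_succ' _ (d + 1),
      add_right_comm, ← sum_add_distrib]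
    simp only [Nat.choose_succ_succ, Nat.choose_zero_right]
    congr 1
    refine sum_congr rfl fun j _ => ?_
    push_cast
    ring
  rw [h1, h2, mul_add, mul_sum]
  congr 1
  refine sum_congr rfl fun j _ => ?_
  have h3 := Nat.add_one_mul_choose_eq d j
  rw [Nat.factorial_succ]
  have h4 : ((d : ℝ) + 1) * d.choose j = (d + 1).choose (j + 1) * (j + 1) := by exact_mod_cast h3
  push_cast
  field_simp
  linarith

theorem le_exp (d : ℕ) : switchBound d ≤ Real.exp (2 * √(d : ℝ)) := by
  have h0 : (0 : ℝ) ≤ √(d : ℝ) := Real.sqrt_nonneg _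
  have hle : ∀ k ∈ range (d + 1), (d.choose k : ℝ) / k.factorial ≤
      (√(d : ℝ) ^ k / k.factorial) * (√(d : ℝ) ^ k / k.factorial) := by
    intro k _
    have h := Nat.choose_le_pow_div (α := ℝ) k d
    calc (d.choose k : ℝ) / k.factorial ≤ (d ^ k / k.factorial : ℝ) / k.factorial := by gcongr
      _ = _ := by
        rw [div_mul_div_comm, ← mul_pow, Real.mul_self_sqrt (Nat.cast_nonneg d), div_div]
  calc switchBound d ≤ ∑ k ∈ range (d + 1),
        (√(d : ℝ) ^ k / k.factorial) * (√(d : ℝ) ^ k / k.factorial) := sum_le_sum hle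
    _ ≤ (∑ k ∈ range (d + 1), √(d : ℝ) ^ k / k.factorial) *
        ∑ k ∈ range (d + 1), √(d : ℝ) ^ k / k.factorial := by
      rw [sum_mul]
      refine sum_le_sum fun k hk => ?_
      gcongr
      exact single_le_sum (f := fun k : ℕ => √(d : ℝ) ^ k / k.factorial)
        (fun _ _ => by positivity) hk
    _ ≤ Real.exp √(d : ℝ) * Real.exp √(d : ℝ) := by
      have := Real.sum_le_exp_of_nonneg h0 (d + 1)
      gcongr
    _ = _ := by rw [← Real.exp_add, two_mul]

/-- If each element of `A` leaves only elements of strictly larger rank, the total bound over `A`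
is largest when the ranks are distinct. -/
theorem sum_card_filter_le {N : Type*} [DecidableEq N] (A : Finset N) (φ : N → ℝ) :
    ∑ i ∈ A, switchBound #{j ∈ A | φ i < φ j} ≤ ∑ k ∈ range #A, switchBound k := by
  induction h : #A generalizing A with
  | zero => simp [card_eq_zero.1 h]
  | succ n ih =>
    obtain ⟨a, ha, hmin⟩ := exists_min_image A φ (card_pos.1 (by omega))
    have hc : #(A.erase a) = n := by rw [card_erase_of_mem ha, h]; rfl
    rw [← sum_erase_add _ _ ha, sum_range_succ]
    refine add_le_add ?_ (mono ?_)
    · rw [← hc] at ih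
      refine le_trans (sum_le_sum fun i hi => mono (card_le_card fun j hj => ?_))
        (hc ▸ ih (A.erase a) rfl)
      have hj := mem_filter.1 hj
      refine mem_filter.2 ⟨mem_erase.2 ⟨?_, hj.1⟩, hj.2⟩
      rintro rfl
      exact hj.2.not_ge (hmin i (mem_of_mem_erase hi))
    · rw [← hc]
      refine card_le_card fun j hj => ?_
      have hj := mem_filter.1 hj
      refine mem_erase.2 ⟨?_, hj.1⟩
      rintro rfl
      exact hj.2.false

end SwitchBound

/-! ### Bland's rule in a binary switching system -/

/-- An abstract binary strategy-improvement scheme: the states in `S` make one of two choices at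
each node in `N`, and have a vector of values. The operation `flip` is only meaningful at improving
nodes, where it changes the choice and increases the value; a state is at least as good as all
states from which it differs at non-improving nodes only. -/
structure SwitchingSystem (N C V S : Type*) where
  choice : S → N → C
  flip : S → N → S
  value : S → V → ℝ
  Improving : S → N → Prop
  choice_flip_of_ne : ∀ {σ i j}, Improving σ i → j ≠ i → choice (flip σ i) j = choice σ j
  choice_flip_self : ∀ {σ i}, Improving σ i → choice (flip σ i) i ≠ choice σ i
  eq_of_ne_of_ne : ∀ {σ ρ i c}, choice σ i ≠ c → choice ρ i ≠ c → (∃ υ, choice υ i = c) →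
    choice σ i = choice ρ i
  value_lt_flip : ∀ {σ i}, Improving σ i → value σ < value (flip σ i)
  improving_congr : ∀ {σ ρ i}, value σ = value ρ → Improving σ i → Improving ρ i
  value_le : ∀ {σ ρ}, (∀ i, choice σ i ≠ choice ρ i → ¬ Improving σ i) → value ρ ≤ value σ

namespace SwitchingSystem

open Finset

/-- Two orders of the nodes agree from rank `p` on. -/
def AgreeFrom {N : Type*} {n : ℕ} (p : ℕ) (Θ Θ' : N ≃ Fin n) : Prop :=
  ∀ i, p ≤ (Θ i : ℕ) → Θ' i = Θ i

theorem AgreeFrom.refl {N : Type*} {n : ℕ} (p : ℕ) (Θ : N ≃ Fin n) : AgreeFrom p Θ Θ :=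
  fun _ _ => rfl

theorem AgreeFrom.le_iff {N : Type*} {n p : ℕ} {Θ Θ' : N ≃ Fin n} (h : AgreeFrom p Θ Θ') (i : N) :
    p ≤ (Θ' i : ℕ) ↔ p ≤ (Θ i : ℕ) := by
  refine ⟨fun hi => ?_, fun hi => (h i hi).symm ▸ hi⟩
  have h1 : Θ (Θ.symm (Θ' i)) = Θ' i := Θ.apply_symm_apply _
  have h2 := h (Θ.symm (Θ' i)) (by rw [h1]; exact hi)
  rw [h1] at h2
  rw [← Θ'.injective h2, h1]
  exact hi

theorem AgreeFrom.symm {N : Type*} {n p : ℕ} {Θ Θ' : N ≃ Fin n} (h : AgreeFrom p Θ Θ') :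
    AgreeFrom p Θ' Θ := fun i hi => (h i ((h.le_iff i).1 hi)).symm

theorem AgreeFrom.trans {N : Type*} {n p : ℕ} {Θ Θ' Θ'' : N ≃ Fin n} (h : AgreeFrom p Θ Θ')
    (h' : AgreeFrom p Θ' Θ'') : AgreeFrom p Θ Θ'' :=
  fun i hi => (h' i ((h.le_iff i).2 hi)).trans (h i hi)

theorem AgreeFrom.mono {N : Type*} {n p q : ℕ} {Θ Θ' : N ≃ Fin n} (h : AgreeFrom p Θ Θ')
    (hpq : p ≤ q) : AgreeFrom q Θ Θ' := fun i hi => h i (hpq.trans hi)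

variable {N C V S : Type*} (R : SwitchingSystem N C V S) {n : ℕ} (Θ : N ≃ Fin n)

open Classical in
/-- The state in which Bland's rule, restricted to the nodes of rank less than `m`, ends when
started at `σ`. The node of rank `m` is flipped only when the nodes before it are settled; it is
then flipped at most once. -/
def bland : ℕ → S → S
  | 0, σ => σ
  | m + 1, σ =>
    if h : ∃ i, (Θ i : ℕ) = m ∧ R.Improving (bland m σ) i then
      bland m (R.flip (bland m σ) h.choose)
    else bland m σ

open Classical in
/-- The number of states visited by `bland`, the initial and the final one included. -/
def numVisited : ℕ → S → ℕ
  | 0, _ => 1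
  | m + 1, σ =>
    if h : ∃ i, (Θ i : ℕ) = m ∧ R.Improving (R.bland Θ m σ) i then
      numVisited m σ + numVisited m (R.flip (R.bland Θ m σ) h.choose)
    else numVisited m σ

variable {R Θ} {m : ℕ} {σ ρ : S} {i : N}

theorem succ_cond (hi : (Θ i : ℕ) = m) (h : R.Improving (R.bland Θ m σ) i) :
    ∃ h : ∃ i, (Θ i : ℕ) = m ∧ R.Improving (R.bland Θ m σ) i, h.choose = i := by
  have hex : ∃ i, (Θ i : ℕ) = m ∧ R.Improving (R.bland Θ m σ) i := ⟨i, hi, h⟩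
  exact ⟨hex, Θ.injective (Fin.ext (hex.choose_spec.1.trans hi.symm))⟩

theorem bland_succ_of_improving (hi : (Θ i : ℕ) = m) (h : R.Improving (R.bland Θ m σ) i) :
    R.bland Θ (m + 1) σ = R.bland Θ m (R.flip (R.bland Θ m σ) i) := by
  obtain ⟨hex, hc⟩ := succ_cond hi h
  rw [bland, dif_pos hex, hc]

theorem bland_succ_of_not (h : ∀ i, (Θ i : ℕ) = m → ¬ R.Improving (R.bland Θ m σ) i) :
    R.bland Θ (m + 1) σ = R.bland Θ m σ := by
  rw [bland, dif_neg]
  rintro ⟨i, hi, h'⟩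
  exact h i hi h'

theorem numVisited_succ_of_improving (hi : (Θ i : ℕ) = m) (h : R.Improving (R.bland Θ m σ) i) :
    R.numVisited Θ (m + 1) σ =
      R.numVisited Θ m σ + R.numVisited Θ m (R.flip (R.bland Θ m σ) i) := by
  obtain ⟨hex, hc⟩ := succ_cond hi h
  rw [numVisited, dif_pos hex, hc]

theorem numVisited_succ_of_not (h : ∀ i, (Θ i : ℕ) = m → ¬ R.Improving (R.bland Θ m σ) i) :
    R.numVisited Θ (m + 1) σ = R.numVisited Θ m σ := by
  rw [numVisited, dif_neg]
  rintro ⟨i, hi, h'⟩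
  exact h i hi h'

/-- Case distinction on the node of rank `m`. -/
theorem succ_cases (R : SwitchingSystem N C V S) (Θ : N ≃ Fin n) (m : ℕ) (σ : S) :
    (∃ i, (Θ i : ℕ) = m ∧ R.Improving (R.bland Θ m σ) i) ∨
      ∀ i, (Θ i : ℕ) = m → ¬ R.Improving (R.bland Θ m σ) i := by
  by_cases h : ∃ i, (Θ i : ℕ) = m ∧ R.Improving (R.bland Θ m σ) i
  · exact .inl h
  · exact .inr fun i hi h' => h ⟨i, hi, h'⟩

theorem numVisited_pos (R : SwitchingSystem N C V S) (Θ : N ≃ Fin n) (m : ℕ) (σ : S) :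
    0 < R.numVisited Θ m σ := by
  induction m generalizing σ with
  | zero => simp [numVisited]
  | succ m ih =>
    rcases succ_cases R Θ m σ with ⟨i, hi, h⟩ | h
    · rw [numVisited_succ_of_improving hi h]
      exact Nat.add_pos_left (ih σ) _
    · rw [numVisited_succ_of_not h]
      exact ih σ

theorem choice_bland (hi : m ≤ (Θ i : ℕ)) : R.choice (R.bland Θ m σ) i = R.choice σ i := by
  induction m generalizing σ with
  | zero => rfl
  | succ m ih =>
    have hm : m ≤ (Θ i : ℕ) := by omega
    rcases succ_cases R Θ m σ with ⟨j, hj, h⟩ | h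
    · rw [bland_succ_of_improving hj h, ih hm, R.choice_flip_of_ne h, ih hm]
      rintro rfl
      omega
    · rw [bland_succ_of_not h, ih hm]

theorem value_le_bland (R : SwitchingSystem N C V S) (Θ : N ≃ Fin n) (m : ℕ) (σ : S) :
    R.value σ ≤ R.value (R.bland Θ m σ) := by
  induction m generalizing σ with
  | zero => rfl
  | succ m ih =>
    rcases succ_cases R Θ m σ with ⟨j, hj, h⟩ | h
    · rw [bland_succ_of_improving hj h]
      exact (ih σ).trans ((R.value_lt_flip h).le.trans (ih _))
    · rw [bland_succ_of_not h]
      exact ih σ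

/-- If the nodes of rank less than `m` are settled, no state with the same choices from rank `m` on
is better. -/
theorem value_le_of_settled (hσ : ∀ i, (Θ i : ℕ) < m → ¬ R.Improving σ i)
    (h : ∀ i, m ≤ (Θ i : ℕ) → R.choice ρ i = R.choice σ i) : R.value ρ ≤ R.value σ :=
  R.value_le fun i hne => hσ i (by
    by_contra! hi
    exact hne (h i hi).symm)

/-- Bland's rule settles all nodes it is allowed to flip: after its only flip, the node of rank `m`
cannot be improving again, since flipping it back would lead to a state that was already beaten. -/
theorem not_improving_bland (hi : (Θ i : ℕ) < m) : ¬ R.Improving (R.bland Θ m σ) i := by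
  induction m generalizing σ i with
  | zero => simp at hi
  | succ m ih =>
    rcases succ_cases R Θ m σ with ⟨j, hj, h⟩ | h
    · rw [bland_succ_of_improving hj h]
      rcases Nat.lt_succ_iff_lt_or_eq.1 hi with hi | hi
      · exact ih hi
      · obtain rfl : i = j := Θ.injective (Fin.ext (hi.trans hj.symm))
        intro h'
        have hbetter := (R.value_lt_flip h).trans_le
          ((R.value_le_bland Θ m _).trans (R.value_lt_flip h').le)
        refine hbetter.not_ge (value_le_of_settled (Θ := Θ) (m := m) (fun _ hk => ih hk)
          fun k hk => ?_)
        rcases eq_or_ne k i with rfl | hki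
        · refine R.eq_of_ne_of_ne (R.choice_flip_self h') ?_ ⟨_, rfl⟩
          rw [choice_bland (σ := R.flip _ _) hk]
          exact (R.choice_flip_self h).symm
        · rw [R.choice_flip_of_ne h' hki, choice_bland hk, R.choice_flip_of_ne h hki]
    · rw [bland_succ_of_not h]
      rcases Nat.lt_succ_iff_lt_or_eq.1 hi with hi | hi
      · exact ih hi
      · exact h i hi

theorem value_le_value_bland (h : ∀ i, m ≤ (Θ i : ℕ) → R.choice ρ i = R.choice σ i) :
    R.value ρ ≤ R.value (R.bland Θ m σ) :=
  value_le_of_settled (Θ := Θ) (m := m) (fun _ hk => not_improving_bland hk)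
    fun i hi => (h i hi).trans (choice_bland hi).symm

/-- The final value depends neither on the order of the nodes of rank less than `m` nor on the
initial choices there. -/
theorem value_bland_congr {Θ' : N ≃ Fin n} (hΘ : AgreeFrom m Θ Θ')
    (h : ∀ i, m ≤ (Θ i : ℕ) → R.choice σ i = R.choice ρ i) :
    R.value (R.bland Θ m σ) = R.value (R.bland Θ' m ρ) := by
  refine le_antisymm (value_le_value_bland fun i hi => ?_) (value_le_value_bland fun i hi => ?_)
  · rw [choice_bland ((hΘ.le_iff i).1 hi), h i ((hΘ.le_iff i).1 hi)]
  · rw [choice_bland ((hΘ.le_iff i).2 hi), h i hi]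

/-- The final choices from rank `p` on depend only on the initial choices and on the order from
rank `p` on. Values that tie can make the final choices before rank `p` depend on more. -/
theorem choice_bland_congr {Θ' : N ≃ Fin n} {p : ℕ} (hΘ : AgreeFrom p Θ Θ')
    (h : ∀ i, p ≤ (Θ i : ℕ) → R.choice σ i = R.choice ρ i) (hi : p ≤ (Θ i : ℕ)) :
    R.choice (R.bland Θ m σ) i = R.choice (R.bland Θ' m ρ) i := by
  induction m generalizing σ ρ i with
  | zero => exact h i hi
  | succ m ih =>
    rcases le_or_gt (m + 1) p with hp | hp
    · rw [choice_bland (hp.trans hi), choice_bland (hp.trans ((hΘ.le_iff i).2 hi)), h i hi]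
    have hpm : p ≤ m := by omega
    have hval : R.value (R.bland Θ m σ) = R.value (R.bland Θ' m ρ) :=
      value_bland_congr (hΘ.mono hpm) fun i hi => h i (hpm.trans hi)
    rcases succ_cases R Θ m σ with ⟨j, hj, hj'⟩ | hn
    · have hj1 : (Θ' j : ℕ) = m := by rw [hΘ j (by omega), hj]
      have hj2 := R.improving_congr hval hj'
      rw [bland_succ_of_improving hj hj', bland_succ_of_improving hj1 hj2]
      refine ih (fun k hk => ?_) hi
      rcases eq_or_ne k j with rfl | hkj
      · refine R.eq_of_ne_of_ne (R.choice_flip_self hj') ?_ ⟨_, rfl⟩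
        rw [ih h hk]
        exact R.choice_flip_self hj2
      · rw [R.choice_flip_of_ne hj' hkj, R.choice_flip_of_ne hj2 hkj, ih h hk]
    · rw [bland_succ_of_not hn, bland_succ_of_not fun j hj hj' =>
        hn j (by rw [← hj, hΘ.symm j (by omega)]) (R.improving_congr hval.symm hj')]
      exact ih h hi

/-! ### Averaging over the orders -/

variable [Fintype N] [Fintype (N ≃ Fin n)]

open Classical in
/-- The orders that agree with `Θ` from rank `m` on. -/
def ordersFrom (m : ℕ) (Θ : N ≃ Fin n) : Finset (N ≃ Fin n) := {Θ' | AgreeFrom m Θ Θ'}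

theorem mem_ordersFrom {Θ Θ' : N ≃ Fin n} : Θ' ∈ ordersFrom m Θ ↔ AgreeFrom m Θ Θ' := by
  simp [ordersFrom]

/-- The order obtained from `Θ` by exchanging the node `i` with the node of rank `m`. -/
def moveTo (Θ : N ≃ Fin n) (m : Fin n) (i : N) : N ≃ Fin n := Θ.trans (Equiv.swap (Θ i) m)

theorem moveTo_self (Θ : N ≃ Fin n) (m : Fin n) (i : N) : moveTo Θ m i i = m := by
  simp [moveTo]

theorem moveTo_of_lt {Θ : N ≃ Fin n} {m : Fin n} (hi : Θ i ≤ m) {j : N} (hj : m < Θ j) :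
    moveTo Θ m i j = Θ j := by
  simp only [moveTo, Equiv.trans_apply]
  exact Equiv.swap_apply_of_ne_of_ne (hi.trans_lt hj).ne' hj.ne'

theorem mem_ordersFrom_moveTo {Θ Θ' : N ≃ Fin n} {m : Fin n} (hi : Θ i ≤ m) :
    Θ' ∈ ordersFrom m (moveTo Θ m i) ↔ Θ' ∈ ordersFrom (m + 1) Θ ∧ Θ' i = m := by
  rw [mem_ordersFrom, mem_ordersFrom]
  constructor
  · refine fun h => ⟨fun j hj => ?_, ?_⟩
    · have := moveTo_of_lt hi (j := j) (Fin.lt_def.2 hj)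
      rw [← this]
      refine h j ?_
      rw [this]
      omega
    · rw [h i (by rw [moveTo_self]), moveTo_self]
  · rintro ⟨h, hm⟩ j hj
    by_cases hji : j = i
    · rw [hji, hm, moveTo_self]
    by_cases hlt : m < Θ j
    · rw [moveTo_of_lt hi hlt, h j hlt]
    · -- Neither `i` nor a node after rank `m`, so `j` lands before rank `m`.
      exfalso
      have hne : moveTo Θ m i j ≠ m := fun h' =>
        hji ((moveTo Θ m i).injective (h'.trans (moveTo_self Θ m i).symm))
      simp only [moveTo, Equiv.trans_apply] at hj hne
      have h1 : Θ j ≠ Θ i := fun h' => hji (Θ.injective h')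
      by_cases h2 : Θ j = m
      · rw [h2, Equiv.swap_apply_right] at hj hne
        exact hne (le_antisymm hi hj)
      · rw [Equiv.swap_apply_of_ne_of_ne h1 h2] at hj
        exact h2 (le_antisymm (not_lt.1 hlt) hj)

open Classical in
/-- Conditioning a sum over orders on the node of rank `m`. -/
theorem sum_ordersFrom_succ (Θ : N ≃ Fin n) (m : Fin n) (F : (N ≃ Fin n) → ℝ) :
    ∑ Θ' ∈ ordersFrom (m + 1) Θ, F Θ' =
      ∑ i with Θ i ≤ m, ∑ Θ' ∈ ordersFrom m (moveTo Θ m i), F Θ' := by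
  rw [← sum_fiberwise_of_maps_to (g := fun Θ' : N ≃ Fin n => Θ'.symm m) (t := {i | Θ i ≤ m})]
  · refine sum_congr rfl fun i hi => sum_congr ?_ fun _ _ => rfl
    ext Θ'
    rw [mem_ordersFrom_moveTo (mem_filter.1 hi).2, mem_filter, Equiv.symm_apply_eq,
      eq_comm (a := m)]
  · intro Θ' hΘ'
    rw [mem_filter]
    refine ⟨mem_univ _, ?_⟩
    by_contra! hlt
    have := mem_ordersFrom.1 hΘ' (Θ'.symm m) hlt
    rw [Equiv.apply_symm_apply] at this
    exact hlt.ne this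

/-- The family `s` of states, one for each order in `ordersFrom m Θ`, is adapted: its choices from
any rank on depend only on the order from that rank on. -/
def IsAdapted (R : SwitchingSystem N C V S) (m : ℕ) (Θ : N ≃ Fin n) (s : (N ≃ Fin n) → S) : Prop :=
  ∀ Θ₁ ∈ ordersFrom m Θ, ∀ Θ₂ ∈ ordersFrom m Θ, ∀ p, AgreeFrom p Θ₁ Θ₂ →
    ∀ i, p ≤ (Θ₁ i : ℕ) → R.choice (s Θ₁) i = R.choice (s Θ₂) i

/-- Among the nodes of rank less than `m`, only those in `A` are active: at the other ones, no state
that agrees with `s Θ'` from rank `m` on and is at least as good has another choice. -/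
def IsActive (R : SwitchingSystem N C V S) (m : ℕ) (Θ : N ≃ Fin n) (s : (N ≃ Fin n) → S)
    (A : Finset N) : Prop :=
  ∀ Θ' ∈ ordersFrom m Θ, ∀ j, (Θ' j : ℕ) < m → j ∉ A → ∀ ρ,
    (∀ i, m ≤ (Θ' i : ℕ) → R.choice ρ i = R.choice (s Θ') i) → R.value (s Θ') ≤ R.value ρ →
    R.choice ρ j = R.choice (s Θ') j

section Step

variable [DecidableEq N] [Fintype V] {s : (N ≃ Fin n) → S} {A : Finset N} {m : Fin n}
  {Θ₀ : N ≃ Fin n}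

theorem agreeFrom_moveTo {Θ' : N ≃ Fin n} (hi : Θ₀ i ≤ m)
    (h : Θ' ∈ ordersFrom m (moveTo Θ₀ m i)) : AgreeFrom (m + 1) Θ₀ Θ' :=
  mem_ordersFrom.1 ((mem_ordersFrom_moveTo hi).1 h).1

theorem IsAdapted.moveTo (hs : R.IsAdapted (m + 1) Θ₀ s) (hi : Θ₀ i ≤ m) :
    R.IsAdapted m (moveTo Θ₀ m i) s := fun Θ₁ h₁ Θ₂ h₂ =>
  hs Θ₁ ((mem_ordersFrom_moveTo hi).1 h₁).1 Θ₂ ((mem_ordersFrom_moveTo hi).1 h₂).1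

theorem IsActive.moveTo (hA : R.IsActive (m + 1) Θ₀ s A) (hi : Θ₀ i ≤ m) :
    R.IsActive m (moveTo Θ₀ m i) s (A.erase i) := by
  intro Θ' hΘ' j hj hjA ρ hρ hle
  have h := (mem_ordersFrom_moveTo hi).1 hΘ'
  refine hA Θ' h.1 j (by omega) (fun hjA' => hjA (mem_erase.2 ⟨?_, hjA'⟩)) ρ
    (fun k hk => hρ k (by omega)) hle
  rintro rfl
  rw [h.2] at hj
  exact hj.false

/-- The value reached when all nodes before `i` are settled, if `i` has rank `m`. -/
def phaseValue (R : SwitchingSystem N C V S) (s : (N ≃ Fin n) → S) (m : Fin n) (Θ₀ : N ≃ Fin n)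
    (i : N) : V → ℝ :=
  R.value (R.bland (SwitchingSystem.moveTo Θ₀ m i) m (s (SwitchingSystem.moveTo Θ₀ m i)))

theorem IsAdapted.phaseValue_eq (hs : R.IsAdapted (m + 1) Θ₀ s) (hi : Θ₀ i ≤ m) {Θ' : N ≃ Fin n}
    (h : Θ' ∈ ordersFrom m (SwitchingSystem.moveTo Θ₀ m i)) :
    R.value (R.bland Θ' m (s Θ')) = R.phaseValue s m Θ₀ i := by
  have hag := mem_ordersFrom.1 h
  exact (value_bland_congr hag
    (hs.moveTo hi _ (mem_ordersFrom.2 (.refl _ _)) _ h m hag)).symm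

/-- A node `j` whose phase value does not exceed that of the flipped node `i` never regains the
choice it has when it is the last one in the order. -/
theorem IsActive.flip (hs : R.IsAdapted (m + 1) Θ₀ s) (hA : R.IsActive (m + 1) Θ₀ s A)
    (hAm : ∀ j ∈ A, Θ₀ j ≤ m) (hi : Θ₀ i ≤ m)
    (himp : ∀ Θ' ∈ ordersFrom m (SwitchingSystem.moveTo Θ₀ m i),
      R.Improving (R.bland Θ' m (s Θ')) i) :
    R.IsActive m (SwitchingSystem.moveTo Θ₀ m i) (fun Θ' => R.flip (R.bland Θ' m (s Θ')) i)
      {j ∈ A | ∑ x, R.phaseValue s m Θ₀ i x < ∑ x, R.phaseValue s m Θ₀ j x} := by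
  intro Θ' hΘ' j hj hjA ρ hρ hle
  have h := (mem_ordersFrom_moveTo hi).1 hΘ'
  have hlt := R.value_lt_flip (himp Θ' hΘ')
  -- Both `ρ` and the state after the flip are as `s Θ'` after rank `m`.
  have hbase : ∀ υ, (∀ k, (m : ℕ) ≤ (Θ' k : ℕ) →
      R.choice υ k = R.choice (R.flip (R.bland Θ' m (s Θ')) i) k) →
      ∀ k, (m : ℕ) + 1 ≤ (Θ' k : ℕ) → R.choice υ k = R.choice (s Θ') k := by
    intro υ hυ k hk
    rw [hυ k (by omega), R.choice_flip_of_ne (himp Θ' hΘ'), choice_bland (by omega)]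
    rintro rfl
    rw [h.2] at hk
    omega
  have hρ' := hbase ρ hρ
  have hσ' := hbase _ fun _ _ => rfl
  have hsle : R.value (s Θ') ≤ R.value (R.flip (R.bland Θ' m (s Θ')) i) :=
    (R.value_le_bland Θ' m _).trans hlt.le
  by_cases hjA' : j ∈ A
  · -- A state with the old choice at `j` is worth at most the phase value of `j`.
    have hkill : ∀ υ, (∀ k, (m : ℕ) + 1 ≤ (Θ' k : ℕ) → R.choice υ k = R.choice (s Θ') k) →
        R.value (R.flip (R.bland Θ' m (s Θ')) i) ≤ R.value υ →
        R.choice υ j ≠ R.choice (s (SwitchingSystem.moveTo Θ₀ m j)) j := by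
      intro υ hυ hυle hυj
      have hmem : SwitchingSystem.moveTo Θ₀ m j ∈
          ordersFrom m (SwitchingSystem.moveTo Θ₀ m j) := mem_ordersFrom.2 (.refl _ _)
      have hjm := hAm j hjA'
      have hmem' := ((mem_ordersFrom_moveTo hjm).1 hmem).1
      have hag : AgreeFrom (m + 1) (SwitchingSystem.moveTo Θ₀ m j) Θ' :=
        (agreeFrom_moveTo hjm hmem).symm.trans (agreeFrom_moveTo hi hΘ')
      have hle2 : R.value υ ≤ R.phaseValue s m Θ₀ j := by
        refine value_le_value_bland fun k hk => ?_
        by_cases hkj : k = j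
        · rw [hkj, hυj]
        · have hk' : (m : ℕ) + 1 ≤ (SwitchingSystem.moveTo Θ₀ m j k : ℕ) := by
            refine Nat.lt_of_le_of_ne hk fun h' => hkj ?_
            refine (SwitchingSystem.moveTo Θ₀ m j).injective ?_
            rw [moveTo_self]
            exact (Fin.ext h').symm
          rw [hυ k ((hag.le_iff k).2 hk'), hs _ hmem' _ h.1 _ hag k hk']
      rw [hs.phaseValue_eq hi hΘ'] at hlt
      have hlt' := hlt.trans_le (hυle.trans hle2)
      refine hjA (mem_filter.2 ⟨hjA', ?_⟩)
      obtain ⟨hle3, x, hx⟩ := Pi.lt_def.1 hlt'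
      exact sum_lt_sum (fun y _ => hle3 y) ⟨x, mem_univ x, hx⟩
    exact R.eq_of_ne_of_ne (hkill ρ hρ' hle) (hkill _ hσ' le_rfl) ⟨_, rfl⟩
  · rw [hA Θ' h.1 j (by omega) hjA' ρ hρ' (hsle.trans hle),
      hA Θ' h.1 j (by omega) hjA' _ hσ' hsle]

theorem IsAdapted.flip (hs : R.IsAdapted (m + 1) Θ₀ s) (hi : Θ₀ i ≤ m)
    (himp : ∀ Θ' ∈ ordersFrom m (SwitchingSystem.moveTo Θ₀ m i),
      R.Improving (R.bland Θ' m (s Θ')) i) :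
    R.IsAdapted m (SwitchingSystem.moveTo Θ₀ m i)
      (fun Θ' => R.flip (R.bland Θ' m (s Θ')) i) := by
  intro Θ₁ h₁ Θ₂ h₂ p hp k hk
  have hb : ∀ k, p ≤ (Θ₁ k : ℕ) →
      R.choice (R.bland Θ₁ m (s Θ₁)) k = R.choice (R.bland Θ₂ m (s Θ₂)) k :=
    fun k hk => choice_bland_congr hp (hs.moveTo hi Θ₁ h₁ Θ₂ h₂ p hp) hk
  rcases eq_or_ne k i with rfl | hki
  · refine R.eq_of_ne_of_ne (R.choice_flip_self (himp Θ₁ h₁)) ?_ ⟨_, rfl⟩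
    rw [hb k hk]
    exact R.choice_flip_self (himp Θ₂ h₂)
  · rw [R.choice_flip_of_ne (himp Θ₁ h₁) hki, R.choice_flip_of_ne (himp Θ₂ h₂) hki, hb k hk]

end Step

/-- The number of states visited, summed over the orders with a given end, for starts that are
adapted and have at most `#A` active nodes. Adaptedness replaces a fixed start: it is inherited by
the state after the flip of the last node, which depends on the order of the other nodes. -/
theorem sum_numVisited_le [Fintype V] (R : SwitchingSystem N C V S) {m : ℕ} (hm : m ≤ n)
    (Θ₀ : N ≃ Fin n) (s : (N ≃ Fin n) → S) (A : Finset N) (hAm : ∀ j ∈ A, (Θ₀ j : ℕ) < m)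
    (hs : R.IsAdapted m Θ₀ s) (hA : R.IsActive m Θ₀ s A) :
    ∑ Θ ∈ ordersFrom m Θ₀, (R.numVisited Θ m (s Θ) : ℝ) ≤ m.factorial * switchBound #A := by
  classical
  induction m generalizing Θ₀ s A with
  | zero =>
    have h1 : ordersFrom 0 Θ₀ = {Θ₀} := by
      ext Θ
      rw [mem_ordersFrom, mem_singleton]
      exact ⟨fun h => Equiv.ext fun i => h i (Nat.zero_le _), fun h => h ▸ .refl _ _⟩
    have h2 := SwitchBound.mono (Nat.zero_le #A)
    rw [SwitchBound.zero] at h2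
    simpa [h1, numVisited] using h2
  | succ m ih =>
    obtain ⟨M, rfl⟩ : ∃ M : Fin n, (M : ℕ) = m := ⟨⟨m, hm⟩, rfl⟩
    have hAM : ∀ j ∈ A, Θ₀ j ≤ M := fun j hj => Nat.lt_succ_iff.1 (hAm j hj)
    let φ : N → ℝ := fun i => ∑ x, R.phaseValue s M Θ₀ i x
    -- The contribution of the orders in which `i` has rank `m`.
    have key : ∀ i, Θ₀ i ≤ M →
        ∑ Θ ∈ ordersFrom M (moveTo Θ₀ M i), (R.numVisited Θ (M + 1) (s Θ) : ℝ) ≤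
          (M : ℕ).factorial * (switchBound #(A.erase i) +
            if i ∈ A then switchBound #{j ∈ A | φ i < φ j} else 0) := by
      intro i hi
      have hrank : ∀ Θ ∈ ordersFrom M (moveTo Θ₀ M i), Θ i = M := fun Θ hΘ =>
        ((mem_ordersFrom_moveTo hi).1 hΘ).2
      have hlt : ∀ j ∈ A, j ≠ i → (moveTo Θ₀ M i j : ℕ) < M := by
        intro j hj hji
        have hmem : moveTo Θ₀ M i ∈ ordersFrom M (moveTo Θ₀ M i) := mem_ordersFrom.2 (.refl _ _)
        have h1 := (agreeFrom_moveTo hi hmem).le_iff j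
        have h2 := hAm j hj
        have h3 : (moveTo Θ₀ M i j : ℕ) ≠ M := fun h' =>
          hji ((moveTo Θ₀ M i).injective ((Fin.ext h').trans (moveTo_self Θ₀ M i).symm))
        omega
      have hphase1 := ih (by omega) (moveTo Θ₀ M i) s (A.erase i)
        (fun j hj => hlt j (mem_of_mem_erase hj) (ne_of_mem_erase hj)) (hs.moveTo hi)
        (hA.moveTo hi)
      -- Whether `i` gets flipped is the same for all these orders.
      by_cases himp : ∀ Θ ∈ ordersFrom M (moveTo Θ₀ M i), R.Improving (R.bland Θ M (s Θ)) i
      · have hiA : i ∈ A := by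
          by_contra hiA
          have hmem : moveTo Θ₀ M i ∈ ordersFrom M (moveTo Θ₀ M i) := mem_ordersFrom.2 (.refl _ _)
          have himp := himp _ hmem
          refine R.choice_flip_self himp ?_
          rw [choice_bland (by rw [hrank _ hmem])]
          refine hA _ ((mem_ordersFrom_moveTo hi).1 hmem).1 i (by rw [hrank _ hmem]; omega) hiA _
            (fun k hk => ?_) ((R.value_le_bland _ _ _).trans (R.value_lt_flip himp).le)
          rw [R.choice_flip_of_ne himp, choice_bland (by omega)]
          rintro rfl
          rw [hrank _ hmem] at hk
          omega
        have hphase2 := ih (by omega) (moveTo Θ₀ M i) _ {j ∈ A | φ i < φ j}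
          (fun j hj => hlt j (mem_filter.1 hj).1 fun h => by
            have := (mem_filter.1 hj).2
            rw [h] at this
            exact this.false)
          (hs.flip hi himp) (hA.flip hs hAM hi himp)
        rw [if_pos hiA, mul_add]
        refine le_trans (le_of_eq ?_) (add_le_add hphase1 hphase2)
        rw [← sum_add_distrib]
        refine sum_congr rfl fun Θ hΘ => ?_
        rw [numVisited_succ_of_improving (congrArg Fin.val (hrank Θ hΘ)) (himp Θ hΘ), Nat.cast_add]
      · push Not at himp
        obtain ⟨Θ₁, hΘ₁, hnot⟩ := himp
        have hle : ∑ Θ ∈ ordersFrom M (moveTo Θ₀ M i), (R.numVisited Θ (M + 1) (s Θ) : ℝ) =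
            ∑ Θ ∈ ordersFrom M (moveTo Θ₀ M i), (R.numVisited Θ M (s Θ) : ℝ) := by
          refine sum_congr rfl fun Θ hΘ => ?_
          rw [numVisited_succ_of_not]
          intro j hj h'
          obtain rfl : j = i := Θ.injective ((Fin.ext hj).trans (hrank Θ hΘ).symm)
          refine hnot (R.improving_congr ?_ h')
          rw [hs.phaseValue_eq hi hΘ, hs.phaseValue_eq hi hΘ₁]
        rw [hle]
        refine hphase1.trans (mul_le_mul_of_nonneg_left (le_add_of_nonneg_right ?_) (by positivity))
        split_ifs
        exacts [SwitchBound.nonneg _, le_rfl]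
    have hcard : #{i | Θ₀ i ≤ M} = (M : ℕ) + 1 := by
      rw [← Fin.card_Iic M, ← card_map Θ₀.symm.toEmbedding]
      congr 1
      ext i
      simp
    have hAI : A ⊆ ({i | Θ₀ i ≤ M} : Finset N) := fun j hj => mem_filter.2 ⟨mem_univ _, hAM j hj⟩
    rw [sum_ordersFrom_succ Θ₀ M fun Θ => (R.numVisited Θ (M + 1) (s Θ) : ℝ)]
    refine (sum_le_sum fun i hi => key i (mem_filter.1 hi).2).trans ?_
    rw [← mul_sum, Nat.factorial_succ, mul_comm ((M : ℕ) + 1), Nat.cast_mul, mul_assoc]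
    refine mul_le_mul_of_nonneg_left ?_ (by positivity)
    rw [← sum_sdiff hAI]
    have hout : ∑ i ∈ ({i | Θ₀ i ≤ M} : Finset N) \ A, (switchBound #(A.erase i) +
        if i ∈ A then switchBound #{j ∈ A | φ i < φ j} else 0) =
        ((M : ℕ) + 1 - #A) * switchBound #A := by
      rw [sum_congr rfl (g := fun _ => switchBound #A), sum_const, card_sdiff_of_subset hAI, hcard,
        nsmul_eq_mul, Nat.cast_sub (hcard ▸ card_le_card hAI)]
      · push_cast; rfl
      · intro i hi
        have hi := (mem_sdiff.1 hi).2
        rw [if_neg hi, erase_eq_of_notMem hi, add_zero]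
    have hin : ∑ i ∈ A, (switchBound #(A.erase i) +
        if i ∈ A then switchBound #{j ∈ A | φ i < φ j} else 0) ≤ #A * switchBound #A := by
      rw [sum_congr rfl (g := fun i => switchBound (#A - 1) + switchBound #{j ∈ A | φ i < φ j}),
        sum_add_distrib, sum_const, nsmul_eq_mul]
      · refine (add_le_add_right (SwitchBound.sum_card_filter_le A φ) _).trans ?_
        rcases Nat.eq_zero_or_eq_succ_pred #A with h0 | h0
        · simp [h0]
        · rw [h0, Nat.succ_sub_one, Nat.succ_eq_add_one]
          push_cast
          exact (SwitchBound.succ_mul _).ge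
      · intro i hi
        rw [if_pos hi, card_erase_of_mem hi]
    rw [hout]
    refine (add_le_add_right hin _).trans (le_of_eq ?_)
    push_cast
    ring

/-- From a fixed start, the number of states visited is on average at most `exp (2 √n)`. -/
theorem sum_numVisited_le_exp [Fintype V] (R : SwitchingSystem N C V S) (σ : S) :
    ∑ Θ : N ≃ Fin n, (R.numVisited Θ n σ : ℝ) ≤ n.factorial * Real.exp (2 * √(n : ℝ)) := by
  classical
  by_cases hne : Nonempty (N ≃ Fin n)
  · obtain ⟨Θ₀⟩ := hne
    have huniv : ordersFrom n Θ₀ = univ := by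
      ext Θ
      simp only [mem_ordersFrom, mem_univ, iff_true]
      exact fun i hi => absurd (Θ₀ i).2 (not_lt.2 hi)
    have h := R.sum_numVisited_le le_rfl Θ₀ (fun _ => σ) univ (fun j _ => (Θ₀ j).2)
      (fun _ _ _ _ _ _ _ _ => rfl) (fun _ _ j _ hj => absurd (mem_univ j) hj)
    rw [huniv, card_univ, Fintype.card_congr Θ₀, Fintype.card_fin] at h
    exact h.trans (mul_le_mul_of_nonneg_left (SwitchBound.le_exp n) (by positivity))
  · rw [not_nonempty_iff] at hne
    rw [Fintype.sum_empty]
    positivity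

end SwitchingSystem

/-! ### The algorithm follows Bland's rule -/

namespace SSG

variable {V : Type*} [Fintype V] [MeasurableSpace V] [DiscreteMeasurableSpace V] {G : SSG V}

open Classical in
/-- The trap-free strategies of a max-binary game form a switching system. -/
def IsMaxBinary.switchingSystem (hG : G.IsMaxBinary) :
    SwitchingSystem G.MaxNode V V {σ : G.MaxStrategy // G.IsTrapFree σ} where
  choice σ x := σ.1.1 x
  flip σ x := if h : G.IsSwitchable σ.1 x then ⟨G.switch σ.1 x, σ.2.switch hG h⟩ else σ
  value σ := G.lowerValue σ.1
  Improving σ x := G.IsSwitchable σ.1 x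
  choice_flip_of_ne h hne := by
    rw [dif_pos h]
    exact switch_of_ne _ hne
  choice_flip_self h := by
    rw [dif_pos h]
    intro heq
    exact (h.lowerValue_switch hG).ne (by rw [heq])
  eq_of_ne_of_ne := by
    rintro σ ρ x c hσ hρ ⟨υ, rfl⟩
    exact hG.eq_of_ne (σ.1.2 x) (ρ.1.2 x) (υ.1.2 x) hσ hρ
  value_lt_flip {σ x} h := by
    rw [dif_pos h]
    exact σ.2.lowerValue_lt_switch hG h
  improving_congr {σ ρ x} heq h := by
    obtain ⟨y, hy, hlt⟩ := h
    refine ⟨y, hy, ?_⟩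
    rw [← σ.2.lowerValue_max, heq, ρ.2.lowerValue_max] at hlt
    exact hlt
  value_le {σ ρ} h := by
    refine σ.2.le_lowerValue (fun τ M hM x hx => absurd hx (ρ.2 τ M hM x)) fun x => ?_
    by_contra! hlt
    exact h x (fun heq => hlt.ne (by rw [heq])) ⟨_, ρ.1.2 x, hlt⟩

theorem IsFirstSwitchable.next_eq {Θ : G.NodeOrder} {σ : G.MaxStrategy} {x : G.MaxNode}
    (h : G.IsFirstSwitchable Θ σ x) :
    G.next Θ σ = none ∨ G.next Θ σ = some (G.switch σ x) := by
  have hex : ∃ x, G.IsFirstSwitchable Θ σ x := ⟨x, h⟩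
  have hx : hex.choose = x := Θ.injective
    (le_antisymm (hex.choose_spec.2 x h.1) (h.2 _ hex.choose_spec.1))
  unfold next
  split_ifs
  · exact .inl rfl
  · exact .inr (by rw [hx])

theorem next_eq_none {Θ : G.NodeOrder} {σ : G.MaxStrategy} (h : ∀ x, ¬ G.IsSwitchable σ x) :
    G.next Θ σ = none := by
  unfold next
  split_ifs with h1 h2
  · rfl
  · exact absurd h2.choose_spec.1 (h _)
  · rfl

theorem exists_isFirstSwitchable (Θ : G.NodeOrder) {σ : G.MaxStrategy} {x : G.MaxNode}
    (h : G.IsSwitchable σ x) : ∃ y, G.IsFirstSwitchable Θ σ y := by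
  obtain ⟨y, hy, hmin⟩ := Set.exists_min_image {y | G.IsSwitchable σ y} Θ (Set.toFinite _) ⟨x, h⟩
  exact ⟨y, hy, hmin⟩

/-- The loop is left only at optimal strategies and at strategies without switchable nodes. -/
theorem of_next_eq_none {Θ : G.NodeOrder} {σ : G.MaxStrategy} (h : G.next Θ σ = none) :
    G.IsOptimal σ ∨ ∀ x, ¬ G.IsSwitchable σ x := by
  by_contra! hcon
  obtain ⟨hopt, x, hx⟩ := hcon
  unfold next at h
  rw [if_neg hopt, dif_pos (exists_isFirstSwitchable Θ hx)] at h
  cases h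

theorem run_add_eq_none {Θ : G.NodeOrder} {σ₀ : G.MaxStrategy} {k : ℕ}
    (h : G.run Θ σ₀ k = none) (j : ℕ) : G.run Θ σ₀ (k + j) = none := by
  induction j with
  | zero => exact h
  | succ j ih => rw [← add_assoc, run, ih, Option.bind_none]

theorem isTrapFree_of_run (hG : G.IsMaxBinary) {Θ : G.NodeOrder} {σ₀ : G.MaxStrategy}
    (h₀ : G.IsTrapFree σ₀) (k : ℕ) {σ : G.MaxStrategy} (h : G.run Θ σ₀ k = some σ) :
    G.IsTrapFree σ := by
  induction k generalizing σ with
  | zero =>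
    obtain rfl : σ₀ = σ := by simpa [run] using h
    exact h₀
  | succ k ih =>
    rw [run, Option.bind_eq_some_iff] at h
    obtain ⟨ρ, hρ, hnext⟩ := h
    unfold next at hnext
    split_ifs at hnext with _ hex
    rw [← Option.some.inj hnext]
    exact (ih hρ).switch hG hex.choose_spec.1

/-- Whenever `bland` flips a node, all nodes of smaller rank are settled, so that this node is the
first switchable one. Hence the algorithm, once at `σ`, performs the flips that lead `bland` from
`σ` to its final state, unless it stops before because it holds an optimal strategy. -/
theorem run_bland (hG : G.IsMaxBinary) (Θ : G.NodeOrder) (σ₀ : G.MaxStrategy) (m : ℕ) (k : ℕ)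
    (σ : {σ : G.MaxStrategy // G.IsTrapFree σ}) (h : G.run Θ σ₀ k = some σ.1) :
    ∃ j, j + 1 = hG.switchingSystem.numVisited Θ m σ ∧
      (G.run Θ σ₀ (k + j) = none ∨
        G.run Θ σ₀ (k + j) = some (hG.switchingSystem.bland Θ m σ).1) := by
  induction m generalizing k σ with
  | zero => exact ⟨0, rfl, .inr h⟩
  | succ m ih =>
    obtain ⟨j, hj, hrun⟩ := ih k σ h
    rcases SwitchingSystem.succ_cases hG.switchingSystem Θ m σ with ⟨i, hi, himp⟩ | hnot
    · rw [SwitchingSystem.numVisited_succ_of_improving hi himp,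
        SwitchingSystem.bland_succ_of_improving hi himp]
      set ρ := hG.switchingSystem.bland Θ m σ with hρ
      have hfirst : G.IsFirstSwitchable Θ ρ.1 i := by
        refine ⟨himp, fun y hy => ?_⟩
        by_contra! hlt
        exact SwitchingSystem.not_improving_bland (R := hG.switchingSystem) (m := m)
          (hi ▸ Fin.lt_def.1 hlt) hy
      have hflip : (hG.switchingSystem.flip ρ i).1 = G.switch ρ.1 i := by
        have : hG.switchingSystem.flip ρ i = ⟨G.switch ρ.1 i, ρ.2.switch hG himp⟩ := dif_pos himp
        rw [this]
      have hstep : G.run Θ σ₀ (k + j + 1) = none ∨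
          G.run Θ σ₀ (k + j + 1) = some (hG.switchingSystem.flip ρ i).1 := by
        rcases hrun with hrun | hrun
        · exact .inl (run_add_eq_none hrun 1)
        · rw [run, hrun, Option.bind_some, hflip]
          exact hfirst.next_eq
      rcases hstep with hstep | hstep
      · have hpos := SwitchingSystem.numVisited_pos hG.switchingSystem Θ m
          (hG.switchingSystem.flip ρ i)
        refine ⟨j + 1 + (hG.switchingSystem.numVisited Θ m (hG.switchingSystem.flip ρ i) - 1),
          by omega, .inl ?_⟩
        rw [← add_assoc]
        exact run_add_eq_none hstep _
      · obtain ⟨j', hj', hrun'⟩ := ih _ _ hstep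
        refine ⟨j + 1 + j', by omega, ?_⟩
        rwa [← add_assoc, ← add_assoc]
    · rw [SwitchingSystem.numVisited_succ_of_not hnot, SwitchingSystem.bland_succ_of_not hnot]
      exact ⟨j, hj, hrun⟩

theorem run_numVisited (hG : G.IsMaxBinary) (Θ : G.NodeOrder)
    (σ₀ : {σ : G.MaxStrategy // G.IsTrapFree σ}) :
    G.run Θ σ₀.1 (hG.switchingSystem.numVisited Θ G.numMax σ₀) = none := by
  obtain ⟨j, hj, hrun⟩ := run_bland hG Θ σ₀.1 G.numMax 0 σ₀ rfl
  rw [← hj]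
  rw [zero_add] at hrun
  rcases hrun with hrun | hrun
  · exact run_add_eq_none hrun 1
  · rw [run, hrun, Option.bind_some]
    exact next_eq_none fun x =>
      SwitchingSystem.not_improving_bland (R := hG.switchingSystem) (Θ x).2

theorem numConsidered_le (hG : G.IsMaxBinary) (Θ : G.NodeOrder)
    (σ₀ : {σ : G.MaxStrategy // G.IsTrapFree σ}) :
    G.numConsidered Θ σ₀.1 ≤ (hG.switchingSystem.numVisited Θ G.numMax σ₀ : ℕ) := by
  have hsub : {k : ℕ | (G.run Θ σ₀.1 k).isSome} ⊆
      (Finset.range (hG.switchingSystem.numVisited Θ G.numMax σ₀) : Set ℕ) := by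
    intro k hk
    rw [Finset.coe_range, Set.mem_Iio]
    by_contra! hle
    obtain ⟨j, rfl⟩ := Nat.exists_eq_add_of_le hle
    have hk : (G.run Θ σ₀.1 _).isSome := hk
    rw [run_add_eq_none (run_numVisited hG Θ σ₀) j] at hk
    cases hk
  refine (Set.encard_le_encard hsub).trans ?_
  rw [Set.encard_coe_eq_coe_finsetCard, Finset.card_range]

/-- The algorithm stops, at a trap-free strategy. -/
theorem exists_returns (hG : G.IsMaxBinary) (Θ : G.NodeOrder) {σ₀ : G.MaxStrategy}
    (h₀ : G.IsTrapFree σ₀) : ∃ σ, G.Returns Θ σ₀ σ ∧ G.IsTrapFree σ := by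
  have hex : ∃ k, G.run Θ σ₀ k = none := ⟨_, run_numVisited hG Θ ⟨σ₀, h₀⟩⟩
  classical
  obtain ⟨k, hk⟩ : ∃ k, Nat.find hex = k + 1 := Nat.exists_eq_succ_of_ne_zero fun h => by
    have := Nat.find_spec hex
    rw [h] at this
    cases this
  obtain ⟨σ, hσ⟩ := Option.ne_none_iff_exists'.1 (Nat.find_min hex (m := k) (by omega))
  have hnone := Nat.find_spec hex
  rw [hk, run, hσ, Option.bind_some] at hnone
  exact ⟨σ, ⟨k, hσ, hnone⟩, isTrapFree_of_run hG h₀ k hσ⟩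

theorem card_nodeOrder (G : SSG V) [Fintype G.NodeOrder] :
    Fintype.card G.NodeOrder = G.numMax.factorial := by
  classical
  have e : G.MaxNode ≃ Fin G.numMax := Finite.equivFin _
  rw [← Nat.card_eq_fintype_card, Nat.card_congr (e.equivCongr (.refl _)),
    Nat.card_eq_fintype_card, Fintype.card_perm, Fintype.card_fin]

theorem expectedConsidered_le (hG : G.IsMaxBinary) {σ₀ : G.MaxStrategy} (h₀ : G.IsTrapFree σ₀) :
    G.expectedConsidered σ₀ ≤ ENNReal.ofReal (Real.exp (2 * √(G.numMax : ℝ))) := by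
  classical
  have hsum := hG.switchingSystem.sum_numVisited_le_exp (n := G.numMax) ⟨σ₀, h₀⟩
  unfold expectedConsidered
  refine ENNReal.div_le_of_le_mul ?_
  rw [card_nodeOrder, ← ENNReal.ofReal_natCast, mul_comm, ← ENNReal.ofReal_mul (by positivity)]
  refine le_trans ?_ (ENNReal.ofReal_le_ofReal hsum)
  rw [ENNReal.ofReal_sum_of_nonneg fun _ _ => Nat.cast_nonneg _]
  refine Finset.sum_le_sum fun Θ _ => ?_
  rw [ENNReal.ofReal_natCast]
  exact_mod_cast ENat.toENNReal_le.2 (numConsidered_le hG Θ ⟨σ₀, h₀⟩)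

end SSG

end

theorem mainTheorem2 {V : Type*} [Fintype V] [MeasurableSpace V] [DiscreteMeasurableSpace V]
    (G : SSG V) (hG : G.IsMaxBinary) (σ₀ : G.MaxStrategy) (hσ₀ : G.IsStopping σ₀) :
    G.expectedConsidered σ₀ ≤ ENNReal.ofReal (Real.exp (2 * √(G.numMax : ℝ))) ∧
    (((∀ x, G.kind x = NodeKind.sink → 0 ≤ G.val x) ∨ (∀ σ : G.MaxStrategy, G.IsStopping σ)) →
      ∀ Θ : G.NodeOrder, ∃ σ : G.MaxStrategy, G.Returns Θ σ₀ σ ∧ G.IsOptimal σ) := by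
  refine ⟨SSG.expectedConsidered_le hG hσ₀.isTrapFree, fun h Θ => ?_⟩
  obtain ⟨σ, hret, hσ⟩ := SSG.exists_returns hG Θ hσ₀.isTrapFree
  refine ⟨σ, hret, ?_⟩
  obtain ⟨-, -, hnext⟩ := hret
  exact (SSG.of_next_eq_none hnext).elim id fun hsw => hσ.isOptimal hsw h
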